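/- Consider a plane geometry given by points, lines, a relation of incidence, a betweenness relation $(ABC)$ ("$B$ lies between $A$ and $C$"), and relations $\cong$ of congruence between segments and between angles. Here a segment $AB$ is the unordered pair of distinct endpoints $A,B$; for $A\neq O$ the ray $OA$ consists of the points $X\ne O$ of the line $OA$ for which $(XOA)$ is false; an angle $\angle AOB$ (with $A,O,B$ noncollinear) is the unordered pair of the rays $OA$, $OB$; and for a point $S$ not on a line $g$ the half plane of $g$ containing $S$ consists of the points $X$ not on $g$ such that no point of $g$ lies between $S$ and $X$. Two lines are called parallel ($\parallel$) if they have no common point. Suppose that Hilbert's plane axioms I–IV hold, no continuity axiom (such as that of Archimedes) being assumed: - (Incidence) Any two distinct points lie on exactly one line; every line contains at least two points; there are three noncollinear points. - (Order) If $(ABC)$, then $A,B,C$ are three distinct collinear points and $(CBA)$. For any distinct $A,B$ there is $C$ with $(ABC)$. Of three points, at most one lies between the other two. If $A,B,C$ are noncollinear and a line through none of $A,B,C$ contains a point between $A$ and $B$, then it contains a point between $A$ and $C$ or a point between $B$ and $C$. - (Congruence) For every segment $AB$ and every ray with origin $A'$ there is a point $B'$ on this ray with $AB\cong A'B'$. If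 $A_1B_1\cong AB$ and $A_2B_2\cong AB$, then $A_1B_1\cong A_2B_2$. If $(ABC)$, $(A'B'C')$, $AB\cong A'B'$ and $BC\cong B'C'$, then $AC\cong A'C'$. Every angle is congruent to itself. For every angle $\angle AOB$, every ray $O'A'$ and every half plane of the line $O'A'$ there is exactly one ray $r$ with origin $O'$ in this half plane such that $\angle AOB$ is congruent to the angle with arms $O'A'$ and $r$. If $ABC$ and $A'B'C'$ are triangles with $AB\cong A'B'$, $AC\cong A'C'$ and $\angle BAC\cong\angle B'A'C'$, then $\angle ABC\cong\angle A'B'C'$. - (Parallel postulate) Through a point outside a line $g$ there is at most one line that does not meet $g$. Then the affine Pappus theorem holds: let $g$ and $g'$ be lines (intersecting or parallel), let $A,B,C$ be points of $g$ not on $g'$, and let $A',B',C'$ be points of $g'$ not on $g$, with $A\neq B$. If $BC'\parallel B'C$ and $AC'\parallel A'C$, then $AB'\parallel A'B$. -/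

import Mathlib

/-- The primitive notions of plane geometry: two sorts of things, points and lines, with
incidence, betweenness, congruence of segments and congruence of angles.
A segment is given by the unordered pair of its endpoints, an angle by the unordered
pair of its two arms (rays, which are sets of points). -/
structure PlaneGeometry (Point Line : Type*) where
  /-- `inc A g`: the point `A` lies on the line `g`. -/
  inc : Point → Line → Prop
  /-- `btw A B C`: the point `B` lies between `A` and `C`. -/
  btw : Point → Point → Point → Prop
  /-- congruence of segments -/
  segCongr : Sym2 Point → Sym2 Point → Prop
  /-- congruence of angles -/
  angCongr : Sym2 (Set Point) → Sym2 (Set Point) → Prop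

namespace PlaneGeometry

variable {Point Line : Type*} (G : PlaneGeometry Point Line)

/-- The points `A`, `B`, `C` lie on a common line. -/
def Collinear (A B C : Point) : Prop :=
  ∃ g : Line, G.inc A g ∧ G.inc B g ∧ G.inc C g

/-- For `A ≠ O`, the half line with origin `O` through `A` (origin excluded): the points of
the line `OA` that lie on the same side of `O` as `A`. -/
def ray (O A : Point) : Set Point :=
  {X | X ≠ O ∧ G.Collinear O A X ∧ ¬ G.btw X O A}

/-- For `S` not on `g`, the half plane of `g` containing `S`: the points `X` outside `g` such
that the segment `SX` contains no point of `g`. -/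
def halfPlane (g : Line) (S : Point) : Set Point :=
  {X | ¬ G.inc X g ∧ ∀ Y, G.inc Y g → ¬ G.btw S Y X}

/-- The angle `∠ A O B` with vertex `O`: the unordered pair of the rays `OA` and `OB`. -/
def angle (A O B : Point) : Sym2 (Set Point) :=
  s(G.ray O A, G.ray O B)

/-- Two lines are parallel if they have no point in common. -/
def Parallel (g h : Line) : Prop :=
  ∀ X, ¬ (G.inc X g ∧ G.inc X h)

/-- The plane axioms of incidence. -/
structure IncidenceAxioms : Prop where
  /-- Two distinct points have a connecting line. -/
  exists_line : ∀ A B : Point, A ≠ B → ∃ g : Line, G.inc A g ∧ G.inc B g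
  /-- Two distinct points have at most one connecting line. -/
  line_unique : ∀ (A B : Point) (g h : Line), A ≠ B →
    G.inc A g → G.inc B g → G.inc A h → G.inc B h → g = h
  /-- On every line there are at least two points. -/
  two_points : ∀ g : Line, ∃ A B : Point, A ≠ B ∧ G.inc A g ∧ G.inc B g
  /-- There are three points that do not lie on one line. -/
  three_points : ∃ A B C : Point, ¬ G.Collinear A B C

/-- The plane axioms of order. -/
structure OrderAxioms : Prop where
  /-- If `B` is between `A` and `C`, then `A`, `B`, `C` are three different points on a line. -/
  btw_distinct : ∀ A B C : Point, G.btw A B C →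
    A ≠ B ∧ B ≠ C ∧ A ≠ C ∧ G.Collinear A B C
  /-- Betweenness is symmetric in the endpoints. -/
  btw_symm : ∀ A B C : Point, G.btw A B C → G.btw C B A
  /-- Every segment can be extended beyond an endpoint. -/
  btw_extend : ∀ A B : Point, A ≠ B → ∃ C, G.btw A B C
  /-- Of three points at most one is between the other two. -/
  btw_unique : ∀ A B C : Point, G.btw A B C → ¬ G.btw B A C ∧ ¬ G.btw A C B
  /-- A line that passes through none of the vertices of a triangle, but through a point of one
  side, passes through a point of one of the other two sides. -/
  pasch : ∀ (A B C : Point) (g : Line), ¬ G.Collinear A B C →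
    ¬ G.inc A g → ¬ G.inc B g → ¬ G.inc C g →
    (∃ X, G.inc X g ∧ G.btw A X B) →
    (∃ X, G.inc X g ∧ G.btw A X C) ∨ (∃ X, G.inc X g ∧ G.btw B X C)

/-- The plane axioms of congruence. -/
structure CongruenceAxioms : Prop where
  /-- A segment can be transported to every half line, starting at its origin. -/
  seg_transport : ∀ A B A' C' : Point, A ≠ B → A' ≠ C' →
    ∃ B' ∈ G.ray A' C', G.segCongr s(A, B) s(A', B')
  /-- Segments congruent to the same segment are congruent. -/
  seg_trans : ∀ A B A₁ B₁ A₂ B₂ : Point, A ≠ B → A₁ ≠ B₁ → A₂ ≠ B₂ →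
    G.segCongr s(A₁, B₁) s(A, B) → G.segCongr s(A₂, B₂) s(A, B) →
    G.segCongr s(A₁, B₁) s(A₂, B₂)
  /-- Additivity of segments. -/
  seg_add : ∀ A B C A' B' C' : Point, G.btw A B C → G.btw A' B' C' →
    G.segCongr s(A, B) s(A', B') → G.segCongr s(B, C) s(B', C') →
    G.segCongr s(A, C) s(A', C')
  /-- Every angle is congruent to itself. -/
  ang_refl : ∀ A O B : Point, ¬ G.Collinear A O B →
    G.angCongr (G.angle A O B) (G.angle A O B)
  /-- Transport of angles: given an angle `∠ A O B`, a half line `O'A'` of a line `g'` and a half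
  plane of `g'`, there is exactly one half line `r` from `O'` in this half plane such that
  `∠ A O B` is congruent to the angle formed by `O'A'` and `r`. -/
  ang_transport : ∀ (A O B O' A' S : Point) (g' : Line), ¬ G.Collinear A O B → O' ≠ A' →
    G.inc O' g' → G.inc A' g' → ¬ G.inc S g' →
    ∃! r : Set Point, (∃ B' ∈ G.halfPlane g' S, r = G.ray O' B') ∧
      G.angCongr (G.angle A O B) s(G.ray O' A', r)
  /-- The weak congruence theorem. -/
  sas : ∀ A B C A' B' C' : Point, ¬ G.Collinear A B C → ¬ G.Collinear A' B' C' →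
    G.segCongr s(A, B) s(A', B') → G.segCongr s(A, C) s(A', C') →
    G.angCongr (G.angle B A C) (G.angle B' A' C') →
    G.angCongr (G.angle A B C) (G.angle A' B' C')

/-- The parallel postulate: through a point outside a line there is at most one line that does
not meet the given line. -/
def ParallelAxiom : Prop :=
  ∀ (P : Point) (g h k : Line), ¬ G.inc P g → G.inc P h → G.inc P k →
    G.Parallel g h → G.Parallel g k → h = k

end PlaneGeometry

/-!
For lines `g` and `g'`, call `h` and `k` antiparallel when the angle from `g'` to `h` equals the
angle from `k` to `g`; in terms of reflections in lines through one point this is the relation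
`σ_h σ_g σ_k = σ_g'`. Opposite sides of a cyclic quadrilateral are antiparallel with respect to the
other two, and conversely antiparallelism of `XZ` and `YW`, with `X`, `Y` on `g` and `Z`, `W` on
`g'`, puts `W` on the circle `XYZ`; hence it implies antiparallelism of `XW` and `YZ`.

Let `D` on `g'` be such that `AD` is antiparallel to `BC'`, hence also to `CB'`. The first gives
that `AC'`, and so also `CA'`, is antiparallel to `BD`, whence `BA'` is antiparallel to `CD`; the
second gives that `AB'` is antiparallel to `CD`. Therefore `AB'` and `BA'` are parallel.

The circles enter only through the perpendicular bisectors of their chords, to which the theorem of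
the three reflections applies, so continuity is not needed.
-/

namespace PlaneGeometry

variable {Point Line : Type*} {G : PlaneGeometry Point Line}

/-- A plane satisfying Hilbert's axioms of incidence. The existence of a line is required because
the axioms of incidence alone also hold in the plane that has one point and no lines. -/
class IncidencePlane (G : PlaneGeometry Point Line) : Prop where
  nonempty_line : Nonempty Line
  incidence : G.IncidenceAxioms

/-- A plane satisfying Hilbert's axioms of incidence and order. -/
class OrderedPlane (G : PlaneGeometry Point Line) : Prop extends IncidencePlane G where
  order : G.OrderAxioms

/-- A plane satisfying Hilbert's axioms of incidence, order and congruence. -/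
class HilbertPlane (G : PlaneGeometry Point Line) : Prop extends OrderedPlane G where
  congruence : G.CongruenceAxioms

/-- A plane satisfying Hilbert's axioms of incidence, order and congruence and the parallel
postulate. -/
class EuclideanPlane (G : PlaneGeometry Point Line) : Prop extends HilbertPlane G where
  parallel : G.ParallelAxiom

/-! ### Incidence -/

lemma ne_of_inc_of_not_inc {A B : Point} {g : Line} (hA : G.inc A g) (hB : ¬ G.inc B g) :
    A ≠ B := by
  rintro rfl
  exact hB hA

lemma Collinear.swap_left {A B C : Point} (h : G.Collinear A B C) : G.Collinear B A C :=
  let ⟨g, hA, hB, hC⟩ := h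
  ⟨g, hB, hA, hC⟩

lemma Collinear.swap_right {A B C : Point} (h : G.Collinear A B C) : G.Collinear A C B :=
  let ⟨g, hA, hB, hC⟩ := h
  ⟨g, hA, hC, hB⟩

lemma Collinear.rotate {A B C : Point} (h : G.Collinear A B C) : G.Collinear B C A :=
  h.swap_left.swap_right

lemma Collinear.reverse {A B C : Point} (h : G.Collinear A B C) : G.Collinear C B A :=
  h.rotate.swap_left

section Incidence

variable [IncidencePlane G]

variable (G) in
lemma exists_line {A B : Point} (hAB : A ≠ B) : ∃ g, G.inc A g ∧ G.inc B g :=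
  IncidencePlane.incidence.exists_line A B hAB

lemma line_unique {A B : Point} {g h : Line} (hAB : A ≠ B) (hAg : G.inc A g) (hBg : G.inc B g)
    (hAh : G.inc A h) (hBh : G.inc B h) : g = h :=
  IncidencePlane.incidence.line_unique A B g h hAB hAg hBg hAh hBh

lemma inter_unique {A B : Point} {g h : Line} (hgh : g ≠ h) (hAg : G.inc A g) (hAh : G.inc A h)
    (hBg : G.inc B g) (hBh : G.inc B h) : A = B := by
  by_contra hAB
  exact hgh (line_unique hAB hAg hBg hAh hBh)

lemma Collinear.inc {A B C : Point} {g : Line} (h : G.Collinear A B C) (hAB : A ≠ B)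
    (hA : G.inc A g) (hB : G.inc B g) : G.inc C g := by
  obtain ⟨k, hAk, hBk, hCk⟩ := h
  rwa [line_unique hAB hA hB hAk hBk]

lemma not_collinear_of_not_inc {A B C : Point} {g : Line} (hAB : A ≠ B) (hA : G.inc A g)
    (hB : G.inc B g) (hC : ¬ G.inc C g) : ¬ G.Collinear A B C :=
  fun h => hC (h.inc hAB hA hB)

variable (G) in
lemma exists_not_inc (g : Line) : ∃ P, ¬ G.inc P g := by
  obtain ⟨A, B, C, h⟩ := IncidencePlane.incidence (G := G).three_points
  by_contra! hg
  exact h ⟨g, hg A, hg B, hg C⟩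

variable (G) in
lemma exists_inc_ne (g : Line) (A : Point) : ∃ B, B ≠ A ∧ G.inc B g := by
  obtain ⟨B, C, hBC, hB, hC⟩ := IncidencePlane.incidence (G := G).two_points g
  by_cases hBA : B = A
  · exact ⟨C, hBA ▸ hBC.symm, hC⟩
  · exact ⟨B, hBA, hB⟩

lemma line_ext {g h : Line} (H : ∀ X, G.inc X g → G.inc X h) : g = h := by
  obtain ⟨A, B, hAB, hA, hB⟩ := IncidencePlane.incidence (G := G).two_points g
  exact line_unique hAB hA hB (H A hA) (H B hB)

lemma exists_inc_not_inc {g h : Line} (hgh : g ≠ h) : ∃ X, G.inc X g ∧ ¬ G.inc X h := by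
  by_contra! H
  exact hgh (line_ext H)

lemma exists_inc_ne_line {O : Point} {k : Line} (hO : G.inc O k) : ∃ g, G.inc O g ∧ g ≠ k := by
  obtain ⟨P, hP⟩ := G.exists_not_inc k
  obtain ⟨g, hOg, hPg⟩ := G.exists_line (ne_of_inc_of_not_inc hO hP)
  exact ⟨g, hOg, fun h => hP (h ▸ hPg)⟩

variable (G) in
lemma collinear_self_left (A B : Point) : G.Collinear A A B := by
  by_cases hAB : A = B
  · obtain ⟨g⟩ := IncidencePlane.nonempty_line (G := G)
    obtain ⟨P, hPA, -⟩ := G.exists_inc_ne g A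
    obtain ⟨k, -, hA⟩ := G.exists_line hPA
    exact ⟨k, hA, hA, hAB ▸ hA⟩
  · obtain ⟨k, hA, hB⟩ := G.exists_line hAB
    exact ⟨k, hA, hA, hB⟩

lemma ne₁₂_of_not_collinear {A B C : Point} (h : ¬ G.Collinear A B C) : A ≠ B := by
  rintro rfl
  exact h (G.collinear_self_left A C)

lemma ne₂₃_of_not_collinear {A B C : Point} (h : ¬ G.Collinear A B C) : B ≠ C :=
  ne₁₂_of_not_collinear (mt Collinear.rotate (mt Collinear.rotate h))

lemma ne₁₃_of_not_collinear {A B C : Point} (h : ¬ G.Collinear A B C) : A ≠ C :=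
  ne₁₂_of_not_collinear (mt Collinear.swap_right h)

lemma exists_line_of_not_collinear {A B C : Point} (h : ¬ G.Collinear A B C) :
    ∃ g, G.inc A g ∧ G.inc B g ∧ ¬ G.inc C g := by
  obtain ⟨g, hA, hB⟩ := G.exists_line (ne₁₂_of_not_collinear h)
  exact ⟨g, hA, hB, fun hC => h ⟨g, hA, hB, hC⟩⟩

lemma not_collinear_of_collinear {A O B P : Point} (h : ¬ G.Collinear A O B) (hPO : P ≠ O)
    (hP : G.Collinear O A P) : ¬ G.Collinear P O B := by
  obtain ⟨k, hO, hA, hPk⟩ := hP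
  exact not_collinear_of_not_inc hPO hPk hO fun hB => h ⟨k, hA, hO, hB⟩

end Incidence

/-! ### Order -/

/-- `A` and `B` lie on different sides of the line `g`. -/
structure OppSide (G : PlaneGeometry Point Line) (g : Line) (A B : Point) : Prop where
  left : ¬ G.inc A g
  right : ¬ G.inc B g
  exists_btw : ∃ Y, G.inc Y g ∧ G.btw A Y B

/-- `A` and `B` lie on the same side of the line `g`. -/
structure SameSide (G : PlaneGeometry Point Line) (g : Line) (A B : Point) : Prop where
  left : ¬ G.inc A g
  right : ¬ G.inc B g
  not_btw : ∀ Y, G.inc Y g → ¬ G.btw A Y B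

lemma oppSide_of_not_sameSide {g : Line} {A B : Point} (hA : ¬ G.inc A g) (hB : ¬ G.inc B g)
    (h : ¬ G.SameSide g A B) : G.OppSide g A B := by
  by_contra h'
  exact h ⟨hA, hB, fun Y hY hAYB => h' ⟨hA, hB, Y, hY, hAYB⟩⟩

lemma sameSide_or_oppSide {g : Line} {A B : Point} (hA : ¬ G.inc A g) (hB : ¬ G.inc B g) :
    G.SameSide g A B ∨ G.OppSide g A B :=
  or_iff_not_imp_left.2 (oppSide_of_not_sameSide hA hB)

lemma OppSide.not_sameSide {g : Line} {A B : Point} (h : G.OppSide g A B) : ¬ G.SameSide g A B :=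
  fun h' => let ⟨Y, hY, hAYB⟩ := h.exists_btw; h'.not_btw Y hY hAYB

section Order

variable [OrderedPlane G]

lemma btw.symm {A B C : Point} (h : G.btw A B C) : G.btw C B A :=
  OrderedPlane.order.btw_symm A B C h

lemma btw.ne₁₂ {A B C : Point} (h : G.btw A B C) : A ≠ B :=
  (OrderedPlane.order.btw_distinct A B C h).1

lemma btw.ne₂₃ {A B C : Point} (h : G.btw A B C) : B ≠ C :=
  (OrderedPlane.order.btw_distinct A B C h).2.1

lemma btw.ne₁₃ {A B C : Point} (h : G.btw A B C) : A ≠ C :=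
  (OrderedPlane.order.btw_distinct A B C h).2.2.1

lemma btw.collinear {A B C : Point} (h : G.btw A B C) : G.Collinear A B C :=
  (OrderedPlane.order.btw_distinct A B C h).2.2.2

lemma btw.inc_right {A B C : Point} {g : Line} (h : G.btw A B C) (hA : G.inc A g)
    (hB : G.inc B g) : G.inc C g :=
  h.collinear.inc h.ne₁₂ hA hB

lemma btw.inc_left {A B C : Point} {g : Line} (h : G.btw A B C) (hB : G.inc B g)
    (hC : G.inc C g) : G.inc A g :=
  h.symm.inc_right hC hB

lemma btw.inc_middle {A B C : Point} {g : Line} (h : G.btw A B C) (hA : G.inc A g)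
    (hC : G.inc C g) : G.inc B g :=
  h.collinear.swap_right.inc h.ne₁₃ hA hC

lemma btw.not_btw_left {A B C : Point} (h : G.btw A B C) : ¬ G.btw B A C :=
  (OrderedPlane.order.btw_unique A B C h).1

variable (G) in
lemma exists_btw {A B : Point} (hAB : A ≠ B) : ∃ C, G.btw A B C :=
  OrderedPlane.order.btw_extend A B hAB

lemma OppSide.symm {g : Line} {A B : Point} (h : G.OppSide g A B) : G.OppSide g B A :=
  let ⟨Y, hY, hAYB⟩ := h.exists_btw
  ⟨h.right, h.left, Y, hY, hAYB.symm⟩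

lemma SameSide.symm {g : Line} {A B : Point} (h : G.SameSide g A B) : G.SameSide g B A :=
  ⟨h.right, h.left, fun Y hY hBYA => h.not_btw Y hY hBYA.symm⟩

lemma SameSide.refl {g : Line} {A : Point} (hA : ¬ G.inc A g) : G.SameSide g A A :=
  ⟨hA, hA, fun _ _ h => h.ne₁₃ rfl⟩

lemma btw.oppSide {A O B : Point} {g : Line} (h : G.btw A O B) (hO : G.inc O g)
    (hA : ¬ G.inc A g) : G.OppSide g A B :=
  ⟨hA, fun hB => hA (h.inc_left hO hB), O, hO, h⟩

lemma OppSide.btw {A O B : Point} {g k : Line} (h : G.OppSide g A B) (hO : G.inc O g)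
    (hAk : G.inc A k) (hOk : G.inc O k) (hBk : G.inc B k) : G.btw A O B := by
  obtain ⟨Y, hY, hAYB⟩ := h.exists_btw
  have hgk : g ≠ k := fun hgk => h.left (hgk ▸ hAk)
  rwa [← inter_unique hgk hY (hAYB.inc_middle hAk hBk) hO hOk]

lemma btw.sameSide {O A B : Point} {g : Line} (h : G.btw O A B) (hO : G.inc O g)
    (hA : ¬ G.inc A g) : G.SameSide g A B := by
  have hB : ¬ G.inc B g := fun hB => hA (h.inc_middle hO hB)
  obtain ⟨k, hOk, hAk, hBk⟩ := h.collinear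
  exact ⟨hA, hB, fun Y hY hAYB =>
    h.not_btw_left (OppSide.btw ⟨hA, hB, Y, hY, hAYB⟩ hO hAk hOk hBk)⟩

lemma OppSide.ne {g : Line} {A B : Point} (h : G.OppSide g A B) : A ≠ B :=
  let ⟨_, _, hAYB⟩ := h.exists_btw; hAYB.ne₁₃

lemma sameSide_of_not_btw {A O B : Point} {g k : Line} (h : ¬ G.btw A O B) (hOg : G.inc O g)
    (hOk : G.inc O k) (hAk : G.inc A k) (hBk : G.inc B k) (hA : ¬ G.inc A g)
    (hB : ¬ G.inc B g) : G.SameSide g A B :=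
  (sameSide_or_oppSide hA hB).resolve_right fun h' => h (h'.btw hOg hAk hOk hBk)

lemma OppSide.or_of_not_collinear {A B C : Point} {g : Line} (h : G.OppSide g A B)
    (hC : ¬ G.inc C g) (hABC : ¬ G.Collinear A B C) : G.OppSide g A C ∨ G.OppSide g B C :=
  (OrderedPlane.order.pasch A B C g hABC h.left h.right hC h.exists_btw).imp
    (⟨h.left, hC, ·⟩) (⟨h.right, hC, ·⟩)

lemma exists_sameSide_not_inc {C : Point} {g k : Line} (hC : ¬ G.inc C g) (hCk : G.inc C k) :
    ∃ P, ¬ G.inc P k ∧ G.SameSide g C P := by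
  obtain ⟨Q, hQ, hQk⟩ := exists_inc_not_inc (G := G) (g := g) (h := k) fun h => hC (h ▸ hCk)
  obtain ⟨P, hP⟩ := G.exists_btw (ne_of_inc_of_not_inc hQ hC)
  exact ⟨P, fun hPk => hQk (hP.inc_left hCk hPk), hP.sameSide hQ hC⟩

lemma OppSide.or {A B C : Point} {g : Line} (h : G.OppSide g A B) (hC : ¬ G.inc C g) :
    G.OppSide g A C ∨ G.OppSide g B C := by
  by_cases hABC : G.Collinear A B C
  swap
  · exact h.or_of_not_collinear hC hABC
  obtain ⟨k, hAk, hBk, hCk⟩ := hABC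
  obtain ⟨P, hPk, hCP⟩ := exists_sameSide_not_inc hC hCk
  have move : ∀ {X : Point}, G.inc X k → G.OppSide g X P → X ≠ C → G.OppSide g X C :=
    fun {X} hX hXP hXC => (hXP.or_of_not_collinear hC
      (mt Collinear.swap_right (not_collinear_of_not_inc hXC hX hCk hPk))).resolve_right
      fun hPC => hPC.symm.not_sameSide hCP
  by_cases hAC : A = C
  · exact Or.inr (hAC ▸ h.symm)
  by_cases hBC : B = C
  · exact Or.inl (hBC ▸ h)
  exact (h.or_of_not_collinear hCP.right (not_collinear_of_not_inc h.ne hAk hBk hPk)).imp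
    (move hAk · hAC) (move hBk · hBC)

lemma OppSide.trans_sameSide {A B C : Point} {g : Line} (h : G.OppSide g A B)
    (h' : G.SameSide g B C) : G.OppSide g A C :=
  (h.or h'.right).resolve_right fun hBC => hBC.not_sameSide h'

lemma SameSide.trans {A B C : Point} {g : Line} (h : G.SameSide g A B)
    (h' : G.SameSide g B C) : G.SameSide g A C :=
  (sameSide_or_oppSide h.left h'.right).resolve_right
    fun hAC => (hAC.trans_sameSide h'.symm).not_sameSide h

/-- Hilbert's proof: if no point of `A`, `B`, `C` were between the other two, then a line through
one of them and a point `D` outside would not separate the other two. Prolonging `BD` to `X`,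
the lines `AD` and `XC` would meet in a point `E`, and the line `BD` would separate `E` and `C`,
so that `X` would lie between `E` and `C`. -/
lemma btw_or_btw_or_btw {A B C : Point} (h : G.Collinear A B C) (hAB : A ≠ B) (hBC : B ≠ C)
    (hAC : A ≠ C) : G.btw A B C ∨ G.btw B A C ∨ G.btw A C B := by
  by_contra! H
  obtain ⟨hB', hA', hC'⟩ := H
  obtain ⟨k, hA, hB, hC⟩ := h
  obtain ⟨D, hD⟩ := G.exists_not_inc k
  have line_through : ∀ {P}, G.inc P k → ∃ l, G.inc P l ∧ G.inc D l ∧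
      ∀ Q, G.inc Q k → P ≠ Q → ¬ G.inc Q l := fun {P} hP => by
    obtain ⟨l, hPl, hDl⟩ := G.exists_line (ne_of_inc_of_not_inc hP hD)
    exact ⟨l, hPl, hDl, fun Q hQ hPQ hQl => hD (line_unique hPQ hPl hQl hP hQ ▸ hDl)⟩
  obtain ⟨a, hAa, hDa, off_a⟩ := line_through hA
  obtain ⟨b, hBb, hDb, off_b⟩ := line_through hB
  obtain ⟨c, hCc, hDc, off_c⟩ := line_through hC
  obtain ⟨X, hBDX⟩ := G.exists_btw (ne_of_inc_of_not_inc hB hD)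
  have hXC_a : G.OppSide a X C := (hBDX.oppSide hDa (off_a B hB hAB)).symm.trans_sameSide
    (sameSide_of_not_btw hA' hAa hA hB hC (off_a B hB hAB) (off_a C hC hAC))
  have hXA_c : G.OppSide c X A := (hBDX.oppSide hDc (off_c B hB hBC.symm)).symm.trans_sameSide
    (sameSide_of_not_btw (fun h => hC' h.symm) hCc hC hB hA (off_c B hB hBC.symm)
      (off_c A hA hAC.symm))
  obtain ⟨E, hEa, hXEC⟩ := hXC_a.exists_btw
  have hEc : ¬ G.inc E c := fun hEc => hXA_c.left (hXEC.inc_left hEc hCc)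
  have hAE_c : G.OppSide c A E :=
    hXA_c.symm.trans_sameSide (hXEC.symm.sameSide hCc hEc).symm
  have hADE : G.btw A D E := hAE_c.btw hDc hAa hDa hEa
  have hEC_b : G.OppSide b E C := (hADE.oppSide hDb (off_b A hA hAB.symm)).symm.trans_sameSide
    (sameSide_of_not_btw hB' hBb hB hA hC (off_b A hA hAB.symm) (off_b C hC hBC))
  obtain ⟨n, hXn, hEn, hCn⟩ := hXEC.collinear
  exact hXEC.not_btw_left (hEC_b.btw (hBDX.inc_right hBb hDb) hEn hXn hCn)

lemma not_btw_of_btw_sides {A B C D E F : Point} (h : ¬ G.Collinear A B C) (hD : G.btw A D B)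
    (hF : G.btw B F C) (hE : G.btw A E C) : ¬ G.btw D E F := by
  intro hDEF
  obtain ⟨b, hA, hC, hB⟩ := exists_line_of_not_collinear (mt Collinear.swap_right h)
  have hDb : ¬ G.inc D b := fun hDb => hB (hD.inc_right hA hDb)
  have hFb : ¬ G.inc F b := fun hFb => hB (hF.inc_left hFb hC)
  exact (hDEF.oppSide (hE.inc_middle hA hC) hDb).not_sameSide
    ((hD.sameSide hA hDb).trans (hF.symm.sameSide hC hFb).symm)

lemma btw.ne_of_btw_of_not_collinear {A B C D E : Point} (h : ¬ G.Collinear A B C)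
    (hD : G.btw A D B) (hE : G.btw A E C) : D ≠ E := by
  rintro rfl
  obtain ⟨g, hA, hD', hB⟩ := hD.collinear
  exact h ⟨g, hA, hB, hE.inc_right hA hD'⟩

lemma not_collinear_of_btw_sides {A B C D E F : Point} (h : ¬ G.Collinear A B C)
    (hD : G.btw A D B) (hF : G.btw B F C) (hE : G.btw A E C) : ¬ G.Collinear D E F := by
  intro hDEF
  have hBAC := mt Collinear.swap_left h
  have hACB := mt Collinear.swap_right h
  rcases btw_or_btw_or_btw hDEF (btw.ne_of_btw_of_not_collinear h hD hE)
    (btw.ne_of_btw_of_not_collinear (mt Collinear.rotate h) hE.symm hF.symm)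
    (btw.ne_of_btw_of_not_collinear (mt Collinear.swap_left h) hD.symm hF) with hb | hb | hb
  · exact not_btw_of_btw_sides h hD hF hE hb
  · exact not_btw_of_btw_sides hACB hE hF.symm hD hb
  · exact not_btw_of_btw_sides hBAC hD.symm hE hF hb

lemma OppSide.trans {A B C : Point} {g : Line} (h : G.OppSide g A B) (h' : G.OppSide g B C) :
    G.SameSide g A C := by
  have noncollinear : ∀ {B}, G.OppSide g A B → G.OppSide g B C → ¬ G.Collinear A B C →
      ¬ G.OppSide g A C := by
    intro B h h' hABC h''
    obtain ⟨D, hD, hADB⟩ := h.exists_btw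
    obtain ⟨F, hF, hBFC⟩ := h'.exists_btw
    obtain ⟨E, hE, hAEC⟩ := h''.exists_btw
    exact not_collinear_of_btw_sides hABC hADB hBFC hAEC ⟨g, hD, hE, hF⟩
  refine (sameSide_or_oppSide h.left h'.right).resolve_right fun h'' => ?_
  by_cases hABC : G.Collinear A B C
  · obtain ⟨k, hAk, hBk, hCk⟩ := hABC
    obtain ⟨P, hPk, hBP⟩ := exists_sameSide_not_inc h.right hBk
    exact noncollinear (h.trans_sameSide hBP) (h'.symm.trans_sameSide hBP).symm
      (mt Collinear.swap_right (not_collinear_of_not_inc h''.ne hAk hCk hPk)) h''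
  · exact noncollinear h h' hABC h''

end Order

/-! ### Rays -/

lemma mem_ray_or_btw {O A X : Point} (h : G.Collinear O A X) (hX : X ≠ O) :
    X ∈ G.ray O A ∨ G.btw X O A :=
  or_iff_not_imp_right.2 fun h' => ⟨hX, h, h'⟩

section Rays

section Incidence

variable [IncidencePlane G]

lemma inc_of_mem_ray {O A X : Point} {g : Line} (hA : A ≠ O) (hX : X ∈ G.ray O A)
    (hOg : G.inc O g) (hAg : G.inc A g) : G.inc X g :=
  hX.2.1.inc hA.symm hOg hAg

lemma not_collinear_of_mem_ray {A O B P Q : Point} (h : ¬ G.Collinear A O B)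
    (hP : P ∈ G.ray O A) (hQ : Q ∈ G.ray O B) : ¬ G.Collinear P O Q :=
  mt Collinear.reverse (not_collinear_of_collinear (mt Collinear.reverse
    (not_collinear_of_collinear h hP.1 hP.2.1)) hQ.1 hQ.2.1)

lemma eq_of_mem_ray_of_mem_ray {A B C D : Point} (h : ¬ G.Collinear A B C)
    (hA : D ∈ G.ray A C) (hB : D ∈ G.ray B C) : D = C := by
  by_contra hDC
  obtain ⟨k, hAk, hCk, hDk⟩ := hA.2.1
  obtain ⟨l, hBl, hCl, hDl⟩ := hB.2.1
  exact h ⟨k, hAk, line_unique hDC hDl hCl hDk hCk ▸ hBl, hCk⟩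

end Incidence

variable [OrderedPlane G]

lemma mem_ray_self {O A : Point} (hA : A ≠ O) : A ∈ G.ray O A :=
  ⟨hA, (G.collinear_self_left A O).reverse.swap_left.swap_left, fun h => h.ne₁₃ rfl⟩

lemma mem_ray_symm {O A B : Point} (hA : A ≠ O) (h : B ∈ G.ray O A) : A ∈ G.ray O B :=
  ⟨hA, h.2.1.swap_right, fun h' => h.2.2 h'.symm⟩

lemma sameSide_of_mem_ray {O A X : Point} {g : Line} (hO : G.inc O g) (hA : ¬ G.inc A g)
    (hX : X ∈ G.ray O A) : G.SameSide g A X := by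
  obtain ⟨hXO, ⟨k, hOk, hAk, hXk⟩, hXOA⟩ := hX
  have hgk : g ≠ k := fun hgk => hA (hgk ▸ hAk)
  exact sameSide_of_not_btw (fun h => hXOA h.symm) hO hOk hAk hXk hA
    fun hXg => hXO (inter_unique hgk hXg hXk hO hOk)

lemma SameSide.mem_ray {O A X : Point} {g : Line} (h : G.SameSide g A X) (hO : G.inc O g)
    (hX : G.Collinear O A X) : X ∈ G.ray O A :=
  ⟨(ne_of_inc_of_not_inc hO h.right).symm, hX, h.symm.not_btw O hO⟩

lemma mem_ray_iff_sameSide {O A X : Point} {g k : Line} (hgk : g ≠ k) (hOg : G.inc O g)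
    (hOk : G.inc O k) (hAk : G.inc A k) (hA : A ≠ O) :
    X ∈ G.ray O A ↔ G.inc X k ∧ G.SameSide g A X :=
  ⟨fun h => ⟨inc_of_mem_ray hA h hOk hAk, sameSide_of_mem_ray hOg
    (fun hAg => hA (inter_unique hgk hAg hAk hOg hOk)) h⟩,
    fun h => h.2.mem_ray hOg ⟨k, hOk, hAk, h.1⟩⟩

lemma mem_ray_trans {O A B C : Point} (hA : A ≠ O) (hB : B ∈ G.ray O A) (hC : C ∈ G.ray O B) :
    C ∈ G.ray O A := by
  obtain ⟨k, hO, hAk, hBk⟩ := hB.2.1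
  obtain ⟨g, hOg, hgk⟩ := exists_inc_ne_line hO
  rw [mem_ray_iff_sameSide hgk hOg hO hAk hA] at hB ⊢
  rw [mem_ray_iff_sameSide hgk hOg hO hBk (ne_of_inc_of_not_inc hOg hB.2.right).symm] at hC
  exact ⟨hC.1, hB.2.trans hC.2⟩

lemma ray_eq_of_mem {O A B : Point} (hA : A ≠ O) (hB : B ∈ G.ray O A) :
    G.ray O B = G.ray O A :=
  Set.ext fun _ => ⟨mem_ray_trans hA hB, mem_ray_trans hB.1 (mem_ray_symm hA hB)⟩

lemma btw.mem_ray_of_btw {A O B C : Point} (h : G.btw A O B) (h' : G.btw A O C) :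
    C ∈ G.ray O B := by
  obtain ⟨k, hA, hO, hB⟩ := h.collinear
  obtain ⟨g, hOg, hgk⟩ := exists_inc_ne_line hO
  have hAg : ¬ G.inc A g := fun hAg => h.ne₁₂ (inter_unique hgk hAg hA hOg hO)
  exact ((h.oppSide hOg hAg).symm.trans (h'.oppSide hOg hAg)).mem_ray hOg
    ⟨k, hO, hB, h'.inc_right hA hO⟩

lemma btw.of_mem_ray {A O B C : Point} (h : G.btw A O B) (hC : C ∈ G.ray O B) :
    G.btw A O C := by
  obtain ⟨k, hA, hO, hB⟩ := h.collinear
  obtain ⟨g, hOg, hgk⟩ := exists_inc_ne_line hO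
  have hAg : ¬ G.inc A g := fun hAg => h.ne₁₂ (inter_unique hgk hAg hA hOg hO)
  rw [mem_ray_iff_sameSide hgk hOg hO hB h.ne₂₃.symm] at hC
  exact ((h.oppSide hOg hAg).trans_sameSide hC.2).btw hOg hA hO hC.1

lemma btw.mem_ray {O A B : Point} (h : G.btw O A B) : B ∈ G.ray O A :=
  ⟨h.ne₁₃.symm, h.collinear, fun h' => h.not_btw_left h'.symm⟩

lemma btw.mem_ray' {O A B : Point} (h : G.btw O A B) : A ∈ G.ray O B :=
  mem_ray_symm h.ne₁₂.symm h.mem_ray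

lemma btw.not_collinear_opposite {A O B C : Point} (hC : G.btw A O C)
    (h : ¬ G.Collinear A O B) : ¬ G.Collinear C O B :=
  not_collinear_of_collinear h hC.ne₂₃.symm hC.collinear.swap_left

lemma btw.not_collinear_extend {A O B C : Point} (hC : G.btw A O C)
    (h : ¬ G.Collinear A O B) : ¬ G.Collinear A C B :=
  mt Collinear.swap_left
    (not_collinear_of_collinear (mt Collinear.swap_left h) hC.ne₁₃.symm hC.collinear)

lemma mem_ray_or_mem_ray_of_inc {k : Line} {P Q X : Point} (hPQ : P ≠ Q) (hP : G.inc P k)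
    (hQ : G.inc Q k) (hX : G.inc X k) : X ∈ G.ray P Q ∨ X ∈ G.ray Q P := by
  rcases eq_or_ne X P with rfl | hXP
  · exact Or.inr (mem_ray_self hPQ)
  · exact (mem_ray_or_btw ⟨k, hP, hQ, hX⟩ hXP).imp_right fun h => h.symm.mem_ray

lemma OppSide.exists_mem_ray_mem_ray {k q : Line} {P Q S T : Point} (hPT : G.OppSide q P T)
    (hST : G.SameSide k S T) (hP : G.inc P k) (hQ : G.inc Q k) (hQq : G.inc Q q)
    (hSq : G.inc S q) : ∃ X, X ∈ G.ray P T ∧ X ∈ G.ray Q S := by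
  obtain ⟨X, hXq, hPXT⟩ := hPT.exists_btw
  have hXk : ¬ G.inc X k := fun hXk => hST.right (hPXT.inc_right hP hXk)
  exact ⟨X, hPXT.mem_ray',
    (hST.trans (hPXT.sameSide hP hXk).symm).mem_ray hQ ⟨q, hQq, hSq, hXq⟩⟩

/-- If the line `r = QT` does not separate `P` and `S`, it meets the segment joining `S` to a point
`R` beyond `Q`, and this puts `T` on the side of `q = QS` containing `R`. -/
lemma SameSide.oppSide_or_oppSide {k q r : Line} {P Q S T : Point} (hST : G.SameSide k S T)
    (hPQ : P ≠ Q) (hP : G.inc P k) (hQ : G.inc Q k) (hQq : G.inc Q q) (hSq : G.inc S q)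
    (hQr : G.inc Q r) (hTr : G.inc T r) (hTq : ¬ G.inc T q) :
    G.OppSide q P T ∨ G.OppSide r P S := by
  have hSr : ¬ G.inc S r := fun hSr =>
    hTq (line_unique (ne_of_inc_of_not_inc hQ hST.left) hQr hSr hQq hSq ▸ hTr)
  have hPq : ¬ G.inc P q := fun h => hST.left (line_unique hPQ h hQq hP hQ ▸ hSq)
  have hPr : ¬ G.inc P r := fun h => hST.right (line_unique hPQ h hQr hP hQ ▸ hTr)
  refine or_iff_not_imp_right.2 fun hPS' => ?_
  have hPS : G.SameSide r P S := (sameSide_or_oppSide hPr hSr).resolve_right hPS'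
  obtain ⟨R, hPQR⟩ := G.exists_btw hPQ
  have hR : G.inc R k := hPQR.inc_right hP hQ
  have hPR : G.OppSide q P R := hPQR.oppSide hQq hPq
  obtain ⟨Y, hYr, hRYS⟩ := ((hPQR.oppSide hQr hPr).symm.trans_sameSide hPS).exists_btw
  have hYk : ¬ G.inc Y k := fun h => hST.left (hRYS.inc_right hR h)
  have hYq : ¬ G.inc Y q := fun h => hPR.right (hRYS.inc_left h hSq)
  have hTY : Y ∈ G.ray Q T :=
    (hST.symm.trans (hRYS.sameSide hR hYk).symm).mem_ray hQ ⟨r, hQr, hTr, hYr⟩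
  exact (hPR.trans_sameSide (hRYS.symm.sameSide hSq hYq).symm).trans_sameSide
    (sameSide_of_mem_ray hQq hTq hTY).symm

/-- The diagonals `PT`, `QS` or the sides `PS`, `QT` intersect, according to whether the line `QS`
separates `P` and `T`. -/
lemma exists_mem_ray_mem_ray {k : Line} {P Q S T : Point} (hPQ : P ≠ Q) (hP : G.inc P k)
    (hQ : G.inc Q k) (hST : G.SameSide k S T) :
    (∃ X, X ∈ G.ray P S ∧ X ∈ G.ray Q T) ∨ (∃ X, X ∈ G.ray P T ∧ X ∈ G.ray Q S) := by
  obtain ⟨q, hQq, hSq⟩ := G.exists_line (ne_of_inc_of_not_inc hQ hST.left)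
  obtain ⟨r, hQr, hTr⟩ := G.exists_line (ne_of_inc_of_not_inc hQ hST.right)
  by_cases hTq : G.inc T q
  · exact Or.inr ⟨T, mem_ray_self (ne_of_inc_of_not_inc hP hST.right).symm,
      hST.mem_ray hQ ⟨q, hQq, hSq, hTq⟩⟩
  · rcases hST.oppSide_or_oppSide hPQ hP hQ hQq hSq hQr hTr hTq with hPT | hPS
    · exact Or.inr (hPT.exists_mem_ray_mem_ray hST hP hQ hQq hSq)
    · exact Or.inl (hPS.exists_mem_ray_mem_ray hST.symm hP hQ hQr hTr)

end Rays

/-! ### Congruence -/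

/-- The length of the segment `AB`, namely its class under congruence. Degenerate segments `A = B`
are admitted and form a class of their own. -/
def len (G : PlaneGeometry Point Line) (A B : Point) : Set (Sym2 Point) :=
  {s | (A = B ∧ s.IsDiag) ∨ (A ≠ B ∧ ¬ s.IsDiag ∧ G.segCongr s s(A, B))}

lemma len_comm (A B : Point) : G.len A B = G.len B A := by
  simp only [len, Sym2.eq_swap (a := A), eq_comm (a := A), ne_eq]

lemma len_eq_reverse {A B C D : Point} (h : G.len A B = G.len C D) : G.len B A = G.len D C := by
  rw [len_comm, h, len_comm]

lemma len_self (A B : Point) : G.len A A = G.len B B := by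
  simp only [len, true_and, ne_eq, not_true_eq_false, false_and, or_false]

lemma angle_comm (A O B : Point) : G.angle A O B = G.angle B O A :=
  Sym2.eq_swap

lemma mem_halfPlane_iff_sameSide {g : Line} {S X : Point} (hS : ¬ G.inc S g) :
    X ∈ G.halfPlane g S ↔ G.SameSide g S X :=
  ⟨fun h => ⟨hS, h.1, h.2⟩, fun h => ⟨h.right, h.not_btw⟩⟩

section Congruence

lemma angle_eq_left [OrderedPlane G] {A O P : Point} (B : Point) (hA : A ≠ O)
    (hP : P ∈ G.ray O A) : G.angle P O B = G.angle A O B := by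
  rw [angle, angle, ray_eq_of_mem hA hP]

lemma angle_eq_right [OrderedPlane G] {O B Q : Point} (A : Point) (hB : B ≠ O)
    (hQ : Q ∈ G.ray O B) : G.angle A O Q = G.angle A O B := by
  rw [angle, angle, ray_eq_of_mem hB hQ]

variable [HilbertPlane G]

variable (G) in
lemma segCongr_refl {A B : Point} (hAB : A ≠ B) : G.segCongr s(A, B) s(A, B) := by
  obtain ⟨C, hC, h⟩ := HilbertPlane.congruence.seg_transport A B A B hAB hAB (G := G)
  exact HilbertPlane.congruence.seg_trans A C A B A B hC.1.symm hAB hAB h h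

lemma segCongr_symm {A B C D : Point} (hAB : A ≠ B) (hCD : C ≠ D)
    (h : G.segCongr s(A, B) s(C, D)) : G.segCongr s(C, D) s(A, B) :=
  HilbertPlane.congruence.seg_trans C D C D A B hCD hCD hAB (G.segCongr_refl hCD) h

lemma segCongr_trans {A B C D E F : Point} (hAB : A ≠ B) (hCD : C ≠ D) (hEF : E ≠ F)
    (h : G.segCongr s(A, B) s(C, D)) (h' : G.segCongr s(C, D) s(E, F)) :
    G.segCongr s(A, B) s(E, F) :=
  HilbertPlane.congruence.seg_trans C D A B E F hCD hAB hEF h (segCongr_symm hCD hEF h')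

lemma mem_len (A B : Point) : s(A, B) ∈ G.len A B := by
  by_cases h : A = B
  · exact Or.inl ⟨h, Sym2.mk_isDiag_iff.2 h⟩
  · exact Or.inr ⟨h, mt Sym2.mk_isDiag_iff.1 h, G.segCongr_refl h⟩

lemma len_eq_len_iff {A B C D : Point} (hAB : A ≠ B) (hCD : C ≠ D) :
    G.len A B = G.len C D ↔ G.segCongr s(A, B) s(C, D) := by
  constructor
  · intro h
    rcases (h ▸ mem_len A B : s(A, B) ∈ G.len C D) with h' | h'
    · exact absurd h'.1 hCD
    · exact h'.2.2
  · intro h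
    ext s
    induction s with | _ X Y =>
    simp only [len, Set.mem_ofPred_eq, hAB, hCD, false_and, false_or, Sym2.mk_isDiag_iff, ne_eq,
      not_false_iff, true_and]
    exact ⟨fun ⟨hXY, h'⟩ => ⟨hXY, segCongr_trans hXY hAB hCD h' h⟩,
      fun ⟨hXY, h'⟩ => ⟨hXY, segCongr_trans hXY hCD hAB h' (segCongr_symm hAB hCD h)⟩⟩

lemma eq_of_len_eq_len_self {A B C : Point} (h : G.len A B = G.len C C) : A = B := by
  rcases (h ▸ mem_len A B : s(A, B) ∈ G.len C C) with h' | h'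
  · exact Sym2.mk_isDiag_iff.1 h'.2
  · exact absurd rfl h'.1

variable (G) in
lemma exists_mem_ray_len_eq {A B O C : Point} (hAB : A ≠ B) (hC : C ≠ O) :
    ∃ D ∈ G.ray O C, G.len O D = G.len A B := by
  obtain ⟨D, hD, h⟩ := HilbertPlane.congruence.seg_transport A B O C hAB hC.symm (G := G)
  exact ⟨D, hD, ((len_eq_len_iff hAB hD.1.symm).2 h).symm⟩

variable (G) in
lemma exists_btw_len_eq {A B C O : Point} (hAB : A ≠ B) (hC : C ≠ O) :
    ∃ D, G.btw C O D ∧ G.len O D = G.len A B := by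
  obtain ⟨E, hE⟩ := G.exists_btw hC
  obtain ⟨D, hD, h⟩ := G.exists_mem_ray_len_eq hAB hE.ne₂₃.symm
  exact ⟨D, hE.of_mem_ray hD, h⟩

lemma len_add {A B C A' B' C' : Point} (h : G.btw A B C) (h' : G.btw A' B' C')
    (hAB : G.len A B = G.len A' B') (hBC : G.len B C = G.len B' C') :
    G.len A C = G.len A' C' :=
  (len_eq_len_iff h.ne₁₃ h'.ne₁₃).2 <| HilbertPlane.congruence.seg_add A B C A' B' C' h h'
    ((len_eq_len_iff h.ne₁₂ h'.ne₁₂).1 hAB) ((len_eq_len_iff h.ne₂₃ h'.ne₂₃).1 hBC)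

lemma angCongr_refl {A O B : Point} (h : ¬ G.Collinear A O B) :
    G.angCongr (G.angle A O B) (G.angle A O B) :=
  HilbertPlane.congruence.ang_refl A O B h

lemma exists_angCongr {A O B O' A' S : Point} {g : Line} (h : ¬ G.Collinear A O B)
    (hA' : A' ≠ O') (hO'g : G.inc O' g) (hA'g : G.inc A' g) (hS : ¬ G.inc S g) :
    ∃ B', G.SameSide g S B' ∧ G.angCongr (G.angle A O B) (G.angle A' O' B') := by
  obtain ⟨r, ⟨⟨B', hB', rfl⟩, h'⟩, -⟩ :=
    HilbertPlane.congruence.ang_transport A O B O' A' S g h hA'.symm hO'g hA'g hS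
  exact ⟨B', (mem_halfPlane_iff_sameSide hS).1 hB', h'⟩

lemma mem_ray_of_angCongr {A O B O' A' P Q : Point} {g : Line} (h : ¬ G.Collinear A O B)
    (hA' : A' ≠ O') (hO'g : G.inc O' g) (hA'g : G.inc A' g) (hPQ : G.SameSide g P Q)
    (hP : G.angCongr (G.angle A O B) (G.angle A' O' P))
    (hQ : G.angCongr (G.angle A O B) (G.angle A' O' Q)) : Q ∈ G.ray O' P := by
  obtain ⟨r, -, hr⟩ :=
    HilbertPlane.congruence.ang_transport A O B O' A' P g h hA'.symm hO'g hA'g hPQ.left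
  have hPr := hr _ ⟨⟨P, (mem_halfPlane_iff_sameSide hPQ.left).2 (.refl hPQ.left), rfl⟩, hP⟩
  have hQr := hr _ ⟨⟨Q, (mem_halfPlane_iff_sameSide hPQ.left).2 hPQ, rfl⟩, hQ⟩
  rw [hPr, ← hQr]
  exact mem_ray_self (ne_of_inc_of_not_inc hO'g hPQ.right).symm

lemma angCongr_of_len_eq_of_angCongr {A B C A' B' C' : Point} (h : ¬ G.Collinear A B C)
    (h' : ¬ G.Collinear A' B' C') (hAB : G.len A B = G.len A' B')
    (hAC : G.len A C = G.len A' C') (hA : G.angCongr (G.angle B A C) (G.angle B' A' C')) :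
    G.angCongr (G.angle A B C) (G.angle A' B' C') :=
  HilbertPlane.congruence.sas A B C A' B' C' h h'
    ((len_eq_len_iff (ne₁₂_of_not_collinear h) (ne₁₂_of_not_collinear h')).1 hAB)
    ((len_eq_len_iff (ne₁₃_of_not_collinear h) (ne₁₃_of_not_collinear h')).1 hAC) hA

lemma eq_of_len_eq_of_mem_ray {O P Q : Point} (hP : P ≠ O) (hQ : Q ∈ G.ray O P)
    (h : G.len O P = G.len O Q) : Q = P := by
  obtain ⟨k, hOk, hPk⟩ := G.exists_line hP.symm
  obtain ⟨D, hD⟩ := G.exists_not_inc k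
  have hDO := (ne_of_inc_of_not_inc hOk hD).symm
  have hODP : ¬ G.Collinear O D P :=
    mt Collinear.swap_right (not_collinear_of_not_inc hP.symm hOk hPk hD)
  obtain ⟨m, hOm, hDm, hPm⟩ := exists_line_of_not_collinear hODP
  have hPQ := sameSide_of_mem_ray hOm hPm hQ
  have hQD : G.angCongr (G.angle O D P) (G.angle O D Q) := by
    refine angCongr_of_len_eq_of_angCongr hODP
      (not_collinear_of_not_inc hDO.symm hOm hDm hPQ.right) rfl h ?_
    rw [angle_eq_right D hP hQ]
    exact angCongr_refl (mt Collinear.swap_left hODP)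
  exact eq_of_mem_ray_of_mem_ray hODP hQ
    (mem_ray_of_angCongr hODP hDO.symm hDm hOm hPQ (angCongr_refl hODP) hQD)

lemma eq_of_len_eq_of_mem_ray_of_mem_ray {O C P Q : Point} (hC : C ≠ O) (hP : P ∈ G.ray O C)
    (hQ : Q ∈ G.ray O C) (h : G.len O P = G.len O Q) : P = Q :=
  (eq_of_len_eq_of_mem_ray hP.1 (mem_ray_trans hP.1 (mem_ray_symm hC hP) hQ) h).symm

lemma len_eq_of_angCongr {A B C A' B' C' : Point} (h : ¬ G.Collinear A B C)
    (h' : ¬ G.Collinear A' B' C') (hAB : G.len A B = G.len A' B') (hAC : G.len A C = G.len A' C')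
    (hA : G.angCongr (G.angle B A C) (G.angle B' A' C')) : G.len B C = G.len B' C' := by
  have hB'A' := (ne₁₂_of_not_collinear h').symm
  have hC'B' := (ne₂₃_of_not_collinear h').symm
  have hBAC := mt Collinear.swap_left h
  obtain ⟨D, hD, hBD⟩ := G.exists_mem_ray_len_eq (ne₂₃_of_not_collinear h) hC'B'
  obtain ⟨g, hA'g, hB'g, hC'g⟩ := exists_line_of_not_collinear h'
  have hC'D := sameSide_of_mem_ray hB'g hC'g hD
  have hAD : G.angCongr (G.angle B A C) (G.angle B' A' D) := by
    refine angCongr_of_len_eq_of_angCongr hBAC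
      (not_collinear_of_not_inc hB'A' hB'g hA'g hC'D.right)
      (len_eq_reverse hAB) hBD.symm ?_
    rw [angle_eq_right A' hC'B' hD]
    exact angCongr_of_len_eq_of_angCongr h h' hAB hAC hA
  rw [← hBD, eq_of_mem_ray_of_mem_ray h'
    (mem_ray_of_angCongr hBAC hB'A' hA'g hB'g hC'D hA hAD) hD]

lemma sas {A B C A' B' C' : Point} (h : ¬ G.Collinear A B C) (h' : ¬ G.Collinear A' B' C')
    (hAB : G.len A B = G.len A' B') (hAC : G.len A C = G.len A' C')
    (hA : G.angCongr (G.angle B A C) (G.angle B' A' C')) :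
    G.len B C = G.len B' C' ∧ G.angCongr (G.angle A B C) (G.angle A' B' C') ∧
      G.angCongr (G.angle A C B) (G.angle A' C' B') :=
  ⟨len_eq_of_angCongr h h' hAB hAC hA, angCongr_of_len_eq_of_angCongr h h' hAB hAC hA,
    angCongr_of_len_eq_of_angCongr (mt Collinear.swap_right h) (mt Collinear.swap_right h') hAC
      hAB (by rwa [angle_comm C, angle_comm C'])⟩

lemma angCongr_of_isosceles {A B C : Point} (h : ¬ G.Collinear A B C)
    (hBC : G.len A B = G.len A C) : G.angCongr (G.angle A B C) (G.angle A C B) := by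
  refine angCongr_of_len_eq_of_angCongr h (mt Collinear.swap_right h) hBC hBC.symm ?_
  rw [angle_comm C]
  exact angCongr_refl (mt Collinear.swap_left h)

lemma angCongr_supplement_of_len_eq {A O B C A' O' B' C' : Point} (h : ¬ G.Collinear A O B)
    (h' : ¬ G.Collinear A' O' B') (hO : G.angCongr (G.angle A O B) (G.angle A' O' B'))
    (hC : G.btw A O C) (hC' : G.btw A' O' C') (hOA : G.len O A = G.len O' A')
    (hOB : G.len O B = G.len O' B') (hOC : G.len O C = G.len O' C') :
    G.angCongr (G.angle C O B) (G.angle C' O' B') := by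
  obtain ⟨hAB, hA, -⟩ := sas (mt Collinear.swap_left h) (mt Collinear.swap_left h') hOA hOB hO
  have hAC : G.len A C = G.len A' C' :=
    len_add hC hC' (len_eq_reverse hOA) hOC
  have hACB := hC.not_collinear_extend h
  have hACB' := hC'.not_collinear_extend h'
  obtain ⟨hCB, -, hC₂⟩ := sas (mt Collinear.swap_right hACB) (mt Collinear.swap_right hACB') hAB
    hAC (by rwa [angle_eq_right B hC.ne₁₂.symm hC.mem_ray, angle_eq_right B' hC'.ne₁₂.symm
      hC'.mem_ray, angle_comm, angle_comm B'])
  refine angCongr_of_len_eq_of_angCongr (hC.not_collinear_opposite h)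
    (hC'.not_collinear_opposite h') (len_eq_reverse hOC)
    (len_eq_reverse hCB) ?_
  rwa [← angle_eq_left B hC.ne₂₃ hC.symm.mem_ray, ← angle_eq_left B' hC'.ne₂₃ hC'.symm.mem_ray]

lemma angCongr_supplement {A O B C A' O' B' C' : Point} (h : ¬ G.Collinear A O B)
    (h' : ¬ G.Collinear A' O' B') (hO : G.angCongr (G.angle A O B) (G.angle A' O' B'))
    (hC : G.btw A O C) (hC' : G.btw A' O' C') :
    G.angCongr (G.angle C O B) (G.angle C' O' B') := by
  have hA' := ne₁₂_of_not_collinear h'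
  have hB' := (ne₂₃_of_not_collinear h').symm
  obtain ⟨P, hP, hOP⟩ := G.exists_mem_ray_len_eq (ne₁₂_of_not_collinear h).symm hA'
  obtain ⟨Q, hQ, hOQ⟩ := G.exists_mem_ray_len_eq (ne₂₃_of_not_collinear h) hB'
  obtain ⟨R, hR, hOR⟩ := G.exists_mem_ray_len_eq hC.ne₂₃ hC'.ne₂₃.symm
  rw [← angle_eq_left B' hC'.ne₂₃.symm hR, ← angle_eq_right R hB' hQ]
  rw [← angle_eq_left B' hA' hP, ← angle_eq_right P hB' hQ] at hO
  exact angCongr_supplement_of_len_eq h (not_collinear_of_mem_ray h' hP hQ) hO hC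
    ((hC'.of_mem_ray hR).symm.of_mem_ray hP).symm hOP.symm hOQ.symm hOR.symm

lemma angCongr_vertical {A O B C D : Point} (h : ¬ G.Collinear A O B) (hC : G.btw A O C)
    (hD : G.btw B O D) : G.angCongr (G.angle C O B) (G.angle D O A) := by
  refine angCongr_supplement h (mt Collinear.reverse h) ?_ hC hD
  rw [angle_comm B]
  exact angCongr_refl h

lemma btw_and_len_eq_of_btw {O B C O' B' C' : Point} (h : G.btw O B C) (hB' : B' ≠ O')
    (hC' : C' ∈ G.ray O' B') (hOB : G.len O B = G.len O' B') (hOC : G.len O C = G.len O' C') :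
    G.btw O' B' C' ∧ G.len B C = G.len B' C' := by
  obtain ⟨D, hD, hBD⟩ := G.exists_btw_len_eq h.ne₂₃ hB'.symm
  obtain rfl : D = C' := eq_of_len_eq_of_mem_ray_of_mem_ray hB' hD.mem_ray hC'
    ((len_add h hD hOB hBD.symm).symm.trans hOC)
  exact ⟨hD, hBD.symm⟩

end Congruence

/-! ### Mirror images -/

/-- `P` and `P'` are mirror images in the line `g`: they lie on different sides of `g`, and every
point of `g` is equidistant from them. -/
structure MirrorImages (G : PlaneGeometry Point Line) (g : Line) (P P' : Point) : Prop where
  oppSide : G.OppSide g P P'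
  len_eq : ∀ X, G.inc X g → G.len X P = G.len X P'

lemma MirrorImages.left {g : Line} {P P' : Point} (h : G.MirrorImages g P P') : ¬ G.inc P g :=
  h.oppSide.left

lemma MirrorImages.right {g : Line} {P P' : Point} (h : G.MirrorImages g P P') : ¬ G.inc P' g :=
  h.oppSide.right

section MirrorImages

lemma MirrorImages.symm [OrderedPlane G] {g : Line} {P P' : Point} (h : G.MirrorImages g P P') :
    G.MirrorImages g P' P :=
  ⟨h.oppSide.symm, fun X hX => (h.len_eq X hX).symm⟩

variable [HilbertPlane G]

lemma mirrorImages_of_angCongr {g : Line} {A B P P' : Point} (hBA : B ≠ A) (hA : G.inc A g)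
    (hB : G.inc B g) (hPP' : G.OppSide g P P') (hAP : G.len A P = G.len A P')
    (h : G.angCongr (G.angle B A P) (G.angle B A P')) : G.MirrorImages g P P' := by
  refine ⟨hPP', fun X hX => ?_⟩
  by_cases hXA : X = A
  · rwa [hXA]
  rcases mem_ray_or_btw ⟨g, hA, hB, hX⟩ hXA with hXAB | hXAB
  · refine len_eq_of_angCongr (not_collinear_of_not_inc (Ne.symm hXA) hA hX hPP'.left)
      (not_collinear_of_not_inc (Ne.symm hXA) hA hX hPP'.right) rfl hAP ?_
    rwa [angle_eq_left P hBA hXAB, angle_eq_left P' hBA hXAB]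
  · obtain ⟨hBP, hB', -⟩ := sas (not_collinear_of_not_inc hBA.symm hA hB hPP'.left)
      (not_collinear_of_not_inc hBA.symm hA hB hPP'.right) rfl hAP h
    refine len_eq_of_angCongr (not_collinear_of_not_inc hXAB.ne₁₃.symm hB hX hPP'.left)
      (not_collinear_of_not_inc hXAB.ne₁₃.symm hB hX hPP'.right) rfl hBP ?_
    rwa [angle_eq_left P hBA.symm hXAB.symm.mem_ray, angle_eq_left P' hBA.symm hXAB.symm.mem_ray]

lemma exists_mirrorImages_of_not_inc {g : Line} {P : Point} (hP : ¬ G.inc P g) :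
    ∃ P', G.MirrorImages g P P' := by
  obtain ⟨A, -, hA⟩ := G.exists_inc_ne g P
  obtain ⟨B, hBA, hB⟩ := G.exists_inc_ne g A
  have hAP := ne_of_inc_of_not_inc hA hP
  obtain ⟨S, hPAS⟩ := G.exists_btw hAP.symm
  have hPS := hPAS.oppSide hA hP
  obtain ⟨T, hST, h⟩ := exists_angCongr (not_collinear_of_not_inc hBA hB hA hP) hBA hA hB hPS.right
  have hTA := (ne_of_inc_of_not_inc hA hST.right).symm
  obtain ⟨P', hP', hAP'⟩ := G.exists_mem_ray_len_eq hAP hTA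
  refine ⟨P', mirrorImages_of_angCongr hBA hA hB ?_ hAP'.symm ?_⟩
  · exact hPS.trans_sameSide (hST.trans (sameSide_of_mem_ray hA hST.right hP'))
  · rwa [angle_eq_right B hTA hP']

lemma MirrorImages.not_collinear {g : Line} {P P' F Y : Point} (h : G.MirrorImages g P P')
    (hF : G.inc F g) (hPFP' : G.btw P F P') (hY : G.inc Y g) (hYF : Y ≠ F) :
    ¬ G.Collinear Y P P' := by
  rintro ⟨m, hYm, hPm, hP'm⟩
  exact h.left (line_unique hYF hYm (hPFP'.inc_middle hPm hP'm) hY hF ▸ hPm)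

lemma MirrorImages.angCongr_foot {g : Line} {P P' F Y : Point} (h : G.MirrorImages g P P')
    (hF : G.inc F g) (hPFP' : G.btw P F P') (hY : G.inc Y g) (hYF : Y ≠ F) :
    G.angCongr (G.angle Y F P) (G.angle Y F P') := by
  have hP := angCongr_of_isosceles (h.not_collinear hF hPFP' hY hYF) (h.len_eq Y hY)
  rw [← angle_eq_right Y hPFP'.ne₁₃.symm hPFP'.mem_ray',
    ← angle_eq_right Y hPFP'.ne₁₃ hPFP'.symm.mem_ray', angle_comm, angle_comm Y P'] at hP
  rw [angle_comm, angle_comm Y]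
  exact angCongr_of_len_eq_of_angCongr
    (mt Collinear.reverse (not_collinear_of_not_inc hYF hY hF h.left))
    (mt Collinear.reverse (not_collinear_of_not_inc hYF hY hF h.right))
    (len_eq_reverse (h.len_eq F hF)) (len_eq_reverse (h.len_eq Y hY)) hP

lemma MirrorImages.exists_angCongr {g : Line} {P P' Y : Point} (h : G.MirrorImages g P P')
    (hY : G.inc Y g) :
    ∃ Z, Z ≠ Y ∧ G.inc Z g ∧ G.angCongr (G.angle Z Y P) (G.angle Z Y P') := by
  obtain ⟨F, hF, hPFP'⟩ := h.oppSide.exists_btw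
  rcases eq_or_ne F Y with rfl | hFY
  · obtain ⟨Z, hZ, hZg⟩ := G.exists_inc_ne g F
    exact ⟨Z, hZ, hZg, h.angCongr_foot hY hPFP' hZg hZ⟩
  · exact ⟨F, hFY, hF, angCongr_of_len_eq_of_angCongr (not_collinear_of_not_inc hFY hF hY h.left)
      (not_collinear_of_not_inc hFY hF hY h.right) rfl (h.len_eq F hF)
      (h.angCongr_foot hF hPFP' hY hFY.symm)⟩

lemma MirrorImages.unique {g : Line} {P P₁ P₂ : Point} (h₁ : G.MirrorImages g P P₁)
    (h₂ : G.MirrorImages g P P₂) : P₁ = P₂ := by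
  obtain ⟨F, hF, hPFP₁⟩ := h₁.oppSide.exists_btw
  obtain ⟨E, hE, hPEP₂⟩ := h₂.oppSide.exists_btw
  have hP₂ : P₂ ∈ G.ray F P₁ := by
    rcases eq_or_ne E F with rfl | hEF
    · exact hPFP₁.mem_ray_of_btw hPEP₂
    have hEFP := not_collinear_of_not_inc hEF hE hF h₁.left
    have hEFP₂ : G.angCongr (G.angle E F P) (G.angle E F P₂) :=
      angCongr_of_len_eq_of_angCongr hEFP (not_collinear_of_not_inc hEF hE hF h₂.right) rfl
        (h₂.len_eq E hE) (h₂.angCongr_foot hE hPEP₂ hF hEF.symm)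
    exact mem_ray_of_angCongr hEFP hEF hF hE (h₁.oppSide.symm.trans h₂.oppSide)
      (h₁.angCongr_foot hF hPFP₁ hE hEF) hEFP₂
  exact (eq_of_len_eq_of_mem_ray hPFP₁.ne₂₃.symm hP₂
    ((h₁.len_eq F hF).symm.trans (h₂.len_eq F hF))).symm

lemma MirrorImages.btw {g : Line} {P P' Q Q' Y : Point} (hP : G.MirrorImages g P P')
    (hQ : G.MirrorImages g Q Q') (hY : G.inc Y g) (hPYQ : G.btw P Y Q) : G.btw P' Y Q' := by
  obtain ⟨Z, hZ, hZg, h⟩ := hP.exists_angCongr hY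
  obtain ⟨R, hP'YR, hYR⟩ :=
    G.exists_btw_len_eq hPYQ.ne₂₃ (ne_of_inc_of_not_inc hY hP.right).symm
  rw [angle_comm, angle_comm Z] at h
  have hQR := angCongr_supplement
    (mt Collinear.reverse (not_collinear_of_not_inc hZ hZg hY hP.left))
    (mt Collinear.reverse (not_collinear_of_not_inc hZ hZg hY hP.right)) h hPYQ hP'YR
  rw [angle_comm, angle_comm R] at hQR
  have hQR_opp : G.OppSide g Q R := (hPYQ.oppSide hY hP.left).symm.trans_sameSide
    (hP.oppSide.trans (hP'YR.oppSide hY hP.right))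
  rwa [hQ.unique (mirrorImages_of_angCongr hZ hY hZg hQR_opp hYR.symm hQR)]

lemma MirrorImages.mem_ray {g : Line} {P P' Q Q' Y : Point} (hP : G.MirrorImages g P P')
    (hQ : G.MirrorImages g Q Q') (hY : G.inc Y g) (h : Q ∈ G.ray Y P) : Q' ∈ G.ray Y P' := by
  obtain ⟨X, hPYX⟩ := G.exists_btw (ne_of_inc_of_not_inc hY hP.left).symm
  obtain ⟨X', hX⟩ := exists_mirrorImages_of_not_inc (hPYX.oppSide hY hP.left).right
  exact (hX.btw hP hY hPYX.symm).mem_ray_of_btw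
    (hX.btw hQ hY (hPYX.symm.of_mem_ray h))

lemma MirrorImages.len_eq_of_mem_ray {g : Line} {P P' Q Q' Y : Point}
    (hP : G.MirrorImages g P P') (hQ : G.MirrorImages g Q Q') (hY : G.inc Y g)
    (h : Q ∈ G.ray Y P) : G.len P Q = G.len P' Q' := by
  have hPY := (ne_of_inc_of_not_inc hY hP.left).symm
  have of_btw : ∀ {P P' Q Q'}, G.MirrorImages g P P' → G.MirrorImages g Q Q' → G.btw Y P Q →
      G.len P Q = G.len P' Q' := fun hP hQ h =>
    (btw_and_len_eq_of_btw h (ne_of_inc_of_not_inc hY hP.right).symm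
      (hP.mem_ray hQ hY h.mem_ray) (hP.len_eq Y hY) (hQ.len_eq Y hY)).2
  rcases eq_or_ne P Q with rfl | hPQ
  · rw [hP.unique hQ, len_self]
  rcases btw_or_btw_or_btw h.2.1 hPY.symm hPQ h.1.symm with hYPQ | hPYQ | hYQP
  · exact of_btw hP hQ hYPQ
  · exact absurd hPYQ.symm h.2.2
  · exact len_eq_reverse (of_btw hQ hP hYQP)

lemma MirrorImages.len_eq_len {g : Line} {P P' Q Q' : Point} (hP : G.MirrorImages g P P')
    (hQ : G.MirrorImages g Q Q') : G.len P Q = G.len P' Q' := by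
  rcases sameSide_or_oppSide hP.left hQ.left with hPQ | hPQ
  swap
  · obtain ⟨Y, hY, hPYQ⟩ := hPQ.exists_btw
    exact len_add hPYQ (hP.btw hQ hY hPYQ) (len_eq_reverse (hP.len_eq Y hY)) (hQ.len_eq Y hY)
  obtain ⟨Y, hY, hPYQ'⟩ := (hQ.oppSide.symm.trans_sameSide hPQ.symm).symm.exists_btw
  have hP'YQ := hP.btw hQ.symm hY hPYQ'
  by_cases hc : G.Collinear P Y Q
  · exact hP.len_eq_of_mem_ray hQ hY (hPQ.mem_ray hY hc.swap_left)
  · have hQ'YQ := hPYQ'.not_collinear_opposite hc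
    exact len_eq_of_angCongr (mt Collinear.swap_left hc)
      (mt Collinear.swap_left (hP'YQ.symm.not_collinear_opposite (mt Collinear.reverse hQ'YQ)))
      (hP.len_eq Y hY) (hQ.len_eq Y hY) (angCongr_vertical hQ'YQ hPYQ'.symm hP'YQ.symm)

lemma btw_of_collinear_of_len_eq {P Q A : Point} (hPQ : P ≠ Q) (h : G.Collinear P A Q)
    (hA : G.len A P = G.len A Q) : G.btw P A Q := by
  have hPA : P ≠ A := by
    rintro rfl
    exact hPQ (eq_of_len_eq_len_self hA.symm)
  have hAQ : A ≠ Q := by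
    rintro rfl
    exact hPQ (eq_of_len_eq_len_self hA).symm
  have not_btw : ∀ {P Q}, P ≠ Q → G.len A P = G.len A Q → ¬ G.btw A P Q := fun hPQ hA h =>
    hPQ (eq_of_len_eq_of_mem_ray h.ne₁₂.symm h.mem_ray hA).symm
  rcases btw_or_btw_or_btw h hPA hAQ hPQ with h | h | h
  · exact h
  · exact absurd h (not_btw hPQ hA)
  · exact absurd h.symm (not_btw hPQ.symm hA.symm)

lemma midpoint_unique {P Q A F : Point} (hA : G.btw P A Q) (hF : G.btw P F Q)
    (hPA : G.len A P = G.len A Q) (hPF : G.len F P = G.len F Q) : A = F := by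
  by_contra hAF
  have not_btw : ∀ {A F}, G.btw P A Q → G.btw P F Q → G.len A P = G.len A Q →
      G.len F P = G.len F Q → ¬ G.btw P A F := fun hA hF hPA hPF h => by
    have hQAF := (btw_and_len_eq_of_btw h hA.ne₂₃
      (mem_ray_trans hA.ne₂₃ hA.symm.mem_ray hF.symm.mem_ray') (len_eq_reverse hPA)
      (len_eq_reverse hPF)).1
    exact (h.symm.mem_ray_of_btw hQAF.symm).2.2 hA.symm
  have hFA : F ∈ G.ray P A := mem_ray_trans hA.ne₁₂.symm hA.mem_ray hF.mem_ray'
  rcases btw_or_btw_or_btw hFA.2.1 hA.ne₁₂ hAF hF.ne₁₂ with h | h | h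
  · exact not_btw hA hF hPA hPF h
  · exact hFA.2.2 h.symm
  · exact not_btw hF hA hPF hPA h

lemma MirrorImages.inc_of_len_eq {g : Line} {P Q A : Point} (h : G.MirrorImages g P Q)
    (hA : G.len A P = G.len A Q) : G.inc A g := by
  by_cases hc : G.Collinear P A Q
  · obtain ⟨F, hF, hPFQ⟩ := h.oppSide.exists_btw
    rwa [midpoint_unique (btw_of_collinear_of_len_eq h.oppSide.ne hc hA) hPFQ hA (h.len_eq F hF)]
  by_contra hAg
  wlog hPA : G.SameSide g P A generalizing P Q
  · exact this h.symm hA.symm (mt Collinear.reverse hc)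
      (h.oppSide.symm.trans (oppSide_of_not_sameSide h.left hAg hPA))
  obtain ⟨Y, hY, hQYA⟩ := (h.oppSide.symm.trans_sameSide hPA).exists_btw
  have hPQA := mt Collinear.swap_right hc
  obtain ⟨k, hPk, hQk, hAk⟩ := exists_line_of_not_collinear hPQA
  have hAY := sameSide_of_mem_ray hQk hAk hQYA.mem_ray'
  have hAQP := mt Collinear.reverse hPQA
  have hYQP := mt Collinear.reverse (not_collinear_of_not_inc h.oppSide.ne hPk hQk hAY.right)
  have hA' := angCongr_of_isosceles hAQP hA.symm
  have hY' := angCongr_of_isosceles hYQP (h.len_eq Y hY).symm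
  rw [angle_comm A P] at hA'
  rw [angle_eq_left P hQYA.ne₁₃.symm hQYA.mem_ray', angle_comm Y P] at hY'
  have hYA : Y = A := eq_of_mem_ray_of_mem_ray hPQA
    (mem_ray_of_angCongr hAQP h.oppSide.ne.symm hPk hQk hAY hA' hY') hQYA.mem_ray'
  exact hAg (hYA ▸ hY)

end MirrorImages

/-! ### Perpendicular bisectors -/

section PerpendicularBisector

variable [HilbertPlane G]

lemma mirrorImages_of_midpoint {k : Line} {B F B' T : Point} (h : ¬ G.Collinear T B B')
    (hF : G.btw B F B') (hFB : G.len F B = G.len F B') (hTB : G.len T B = G.len T B')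
    (hFk : G.inc F k) (hTk : G.inc T k) : G.MirrorImages k B B' := by
  have hTF : T ≠ F := by
    rintro rfl
    exact h hF.collinear.swap_left
  have hBk : ¬ G.inc B k := fun hBk => h ⟨k, hTk, hBk, hF.inc_right hBk hFk⟩
  have hB'k : ¬ G.inc B' k := fun hB'k => hBk (hF.inc_left hFk hB'k)
  have hB := angCongr_of_isosceles h hTB
  rw [← angle_eq_right T hF.ne₁₃.symm hF.mem_ray', ← angle_eq_right T hF.ne₁₃ hF.symm.mem_ray',
    angle_comm, angle_comm T B'] at hB
  have hFTB := angCongr_of_len_eq_of_angCongr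
    (mt Collinear.rotate (not_collinear_of_not_inc hTF.symm hFk hTk hBk))
    (mt Collinear.rotate (not_collinear_of_not_inc hTF.symm hFk hTk hB'k))
    (len_eq_reverse hFB) (len_eq_reverse hTB) hB
  rw [angle_comm, angle_comm B'] at hFTB
  exact mirrorImages_of_angCongr hTF hFk hTk (hF.oppSide hFk hBk) hFB hFTB

/-- If `E` is the point of the base with `QE = PF`, the triangles `PFX` and `QEX` are congruent, so
that `E`, too, is the foot of the perpendicular from `X`. -/
lemma midpoint_of_isosceles_of_mem_ray {k : Line} {X X' F P Q : Point} (hPQ : P ≠ Q)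
    (hP : G.inc P k) (hQ : G.inc Q k) (hX : G.MirrorImages k X X') (hXFX' : G.btw X F X')
    (hXP : G.len X P = G.len X Q) (hF : F ∈ G.ray P Q) :
    G.btw P F Q ∧ G.len F P = G.len F Q := by
  have hFk := inc_of_mem_ray hPQ.symm hF hP hQ
  obtain ⟨E, hE, hQE⟩ := G.exists_mem_ray_len_eq hF.1.symm hPQ
  have hEk := inc_of_mem_ray hPQ hE hQ hP
  have hXE := (ne_of_inc_of_not_inc hEk hX.left).symm
  have hXP_Q := angCongr_of_isosceles
    (mt Collinear.rotate (not_collinear_of_not_inc hPQ hP hQ hX.left)) hXP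
  rw [← angle_eq_right X hPQ.symm hF, ← angle_eq_right X hPQ hE] at hXP_Q
  have hPXF := mt Collinear.swap_right (not_collinear_of_not_inc hF.1.symm hP hFk hX.left)
  have hQXE := mt Collinear.swap_right (not_collinear_of_not_inc hE.1.symm hQ hEk hX.left)
  obtain ⟨hXF, -, hFTB⟩ := sas hPXF hQXE (len_eq_reverse hXP) hQE.symm hXP_Q
  rw [angle_comm, angle_comm Q] at hFTB
  obtain ⟨Y, hXEY, hEY⟩ := G.exists_btw_len_eq hXE.symm hXE
  have hXFP := mt Collinear.reverse (not_collinear_of_not_inc hF.1.symm hP hFk hX.left)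
  have hXEQ := mt Collinear.reverse (not_collinear_of_not_inc hE.1.symm hQ hEk hX.left)
  have hX'P : G.len X' P = G.len Y Q := len_eq_of_angCongr
    (mt Collinear.swap_left (hXFX'.not_collinear_opposite hXFP))
    (mt Collinear.swap_left (hXEY.not_collinear_opposite hXEQ))
    ((hX.len_eq F hFk).symm.trans ((len_eq_reverse hXF).trans hEY.symm))
    (len_eq_reverse hQE.symm) (angCongr_supplement hXFP hXEQ hFTB hXFX' hXEY)
  have hXY : G.MirrorImages k X Y := mirrorImages_of_midpoint
    (mt Collinear.rotate (hXEY.not_collinear_extend hXEQ)) hXEY hEY.symm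
    ((len_eq_reverse hXP).symm.trans ((hX.len_eq P hP).trans (len_eq_reverse hX'P))) hEk hQ
  obtain rfl := hX.unique hXY
  obtain ⟨l, hXl, hFl, hX'l⟩ := hXFX'.collinear
  have hkl : k ≠ l := by
    rintro rfl
    exact hX.left hXl
  obtain rfl : F = E := inter_unique hkl hFk hFl hEk (hXEY.inc_middle hXl hX'l)
  have hFP := len_eq_reverse hQE.symm
  exact ⟨btw_of_collinear_of_len_eq hPQ ⟨k, hP, hFk, hQ⟩ hFP, hFP⟩

lemma exists_mirrorImages_of_isosceles {k : Line} {P Q X : Point} (hPQ : P ≠ Q)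
    (hP : G.inc P k) (hQ : G.inc Q k) (hX : ¬ G.inc X k) (hXP : G.len X P = G.len X Q) :
    ∃ g, G.inc X g ∧ G.MirrorImages g P Q := by
  obtain ⟨X', hXX'⟩ := exists_mirrorImages_of_not_inc hX
  obtain ⟨F, hFk, hXFX'⟩ := hXX'.oppSide.exists_btw
  wlog hF : F ∈ G.ray P Q generalizing P Q
  · obtain ⟨g, hXg, hg⟩ := this hPQ.symm hQ hP hXP.symm
      ((mem_ray_or_mem_ray_of_inc hPQ hP hQ hFk).resolve_left hF)
    exact ⟨g, hXg, hg.symm⟩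
  obtain ⟨hPFQ, hFP⟩ := midpoint_of_isosceles_of_mem_ray hPQ hP hQ hXX' hXFX' hXP hF
  obtain ⟨g, hFg, hXg⟩ := G.exists_line (ne_of_inc_of_not_inc hFk hX)
  have hXPQ := mt Collinear.rotate (not_collinear_of_not_inc hPQ hP hQ hX)
  exact ⟨g, hXg, mirrorImages_of_midpoint hXPQ hPFQ hFP hXP hFg hXg⟩

/-- The perpendicular bisector of `SS'` would contain both `P` and `Q`. -/
lemma eq_of_len_eq_of_sameSide {k : Line} {P Q S S' : Point} (hPQ : P ≠ Q) (hP : G.inc P k)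
    (hQ : G.inc Q k) (hS : G.SameSide k S S') (hPS : G.len P S = G.len P S')
    (hQS : G.len Q S = G.len Q S') : S = S' := by
  by_contra hSS'
  by_cases hc : G.Collinear S P S'
  · exact hS.not_btw P hP (btw_of_collinear_of_len_eq hSS' hc hPS)
  obtain ⟨l, hSl, hS'l, hPl⟩ := exists_line_of_not_collinear (mt Collinear.swap_right hc)
  obtain ⟨g, hPg, hg⟩ := exists_mirrorImages_of_isosceles hSS' hSl hS'l hPl hPS
  obtain rfl : g = k := line_unique hPQ hPg (hg.inc_of_len_eq hQS) hP hQ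
  exact hg.oppSide.not_sameSide hS

lemma angCongr_symm_of_len_eq {A O B A' O' B' : Point} (h : ¬ G.Collinear A O B)
    (h' : ¬ G.Collinear A' O' B') (hOA : G.len O A = G.len O' A')
    (hOB : G.len O B = G.len O' B') (hO : G.angCongr (G.angle A O B) (G.angle A' O' B')) :
    G.angCongr (G.angle A' O' B') (G.angle A O B) := by
  obtain ⟨k, hAk, hOk, hB⟩ := exists_line_of_not_collinear h
  have hAO := ne₁₂_of_not_collinear h
  obtain ⟨D, hBD, hD⟩ := exists_angCongr h' hAO hOk hAk hB
  have hDO := (ne_of_inc_of_not_inc hOk hBD.right).symm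
  obtain ⟨C, hC, hOC⟩ := G.exists_mem_ray_len_eq (ne₂₃_of_not_collinear h') hDO
  rw [← angle_eq_right A hDO hC] at hD
  have hBC := hBD.trans (sameSide_of_mem_ray hOk hBD.right hC)
  have hAC := len_eq_of_angCongr (mt Collinear.swap_left h')
    (mt Collinear.swap_left (not_collinear_of_not_inc hAO hAk hOk hBC.right)) hOA.symm hOC.symm hD
  have hAB := len_eq_of_angCongr (mt Collinear.swap_left h) (mt Collinear.swap_left h') hOA hOB hO
  rwa [eq_of_len_eq_of_sameSide hAO hAk hOk hBC (hAB.trans hAC) (hOB.trans hOC.symm)]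

lemma angCongr_symm {A O B A' O' B' : Point} (h : ¬ G.Collinear A O B)
    (h' : ¬ G.Collinear A' O' B') (hO : G.angCongr (G.angle A O B) (G.angle A' O' B')) :
    G.angCongr (G.angle A' O' B') (G.angle A O B) := by
  have hA' := ne₁₂_of_not_collinear h'
  have hB' := (ne₂₃_of_not_collinear h').symm
  obtain ⟨C, hC, hOC⟩ := G.exists_mem_ray_len_eq (ne₁₂_of_not_collinear h).symm hA'
  obtain ⟨D, hD, hOD⟩ := G.exists_mem_ray_len_eq (ne₂₃_of_not_collinear h) hB'
  rw [← angle_eq_left B' hA' hC, ← angle_eq_right C hB' hD] at hO ⊢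
  exact angCongr_symm_of_len_eq h (not_collinear_of_mem_ray h' hC hD) hOC.symm hOD.symm hO

lemma len_eq_of_base_angCongr {P Q X : Point} (h : ¬ G.Collinear P Q X)
    (hPQ : G.angCongr (G.angle P Q X) (G.angle Q P X)) : G.len X P = G.len X Q := by
  obtain ⟨k, hP, hQ, hX⟩ := exists_line_of_not_collinear h
  have hQP := (ne₁₂_of_not_collinear h).symm
  have hXP := (ne₁₃_of_not_collinear h).symm
  have h' := mt Collinear.swap_left h
  obtain ⟨Y, hY, hPY⟩ := G.exists_mem_ray_len_eq (ne₂₃_of_not_collinear h) hXP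
  have hXY := sameSide_of_mem_ray hP hX hY
  rw [← angle_eq_right Q hXP hY] at hPQ
  have hQPX : G.angCongr (G.angle Q P X) (G.angle P Q Y) :=
    angCongr_of_len_eq_of_angCongr h'
      (not_collinear_of_not_inc hQP.symm hP hQ hXY.right) (len_comm Q P) hPY.symm hPQ
  rw [angle_eq_right Q hXP hY] at hPQ
  have hYQX : Y ∈ G.ray Q X :=
    mem_ray_of_angCongr h' hQP.symm hQ hP hXY (angCongr_symm h h' hPQ) hQPX
  rw [len_comm X Q, ← hPY, eq_of_mem_ray_of_mem_ray h hY hYQX, len_comm]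

lemma exists_isosceles {k : Line} {P Q : Point} (hPQ : P ≠ Q) (hP : G.inc P k)
    (hQ : G.inc Q k) : ∃ X, ¬ G.inc X k ∧ G.len X P = G.len X Q := by
  obtain ⟨S, hS⟩ := G.exists_not_inc k
  have hQPS := not_collinear_of_not_inc hPQ.symm hQ hP hS
  obtain ⟨R, hSR, hR⟩ := exists_angCongr hQPS hPQ hQ hP hS
  have hRQ := (ne_of_inc_of_not_inc hQ hSR.right).symm
  have hSP := (ne_of_inc_of_not_inc hP hS).symm
  obtain ⟨T, hT, hQT⟩ := G.exists_mem_ray_len_eq hSP.symm hRQ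
  have hST := hSR.trans (sameSide_of_mem_ray hQ hSR.right hT)
  rw [← angle_eq_right P hRQ hT] at hR
  have hPQT := not_collinear_of_not_inc hPQ hP hQ hST.right
  have hPQS := angCongr_of_len_eq_of_angCongr (mt Collinear.swap_left hQPS)
    (mt Collinear.swap_left hPQT) (len_comm P Q) hQT.symm hR
  have hTQ := (ne_of_inc_of_not_inc hQ hST.right).symm
  rcases exists_mem_ray_mem_ray hPQ hP hQ hST with ⟨X, hXS, hXT⟩ | ⟨X, hXT, hXS⟩
  · have hX := (sameSide_of_mem_ray hP hS hXS).right
    have hPQX := not_collinear_of_not_inc hPQ hP hQ hX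
    rw [← angle_eq_right Q hSP hXS, ← angle_eq_right P hTQ hXT] at hR
    exact ⟨X, hX, len_eq_of_base_angCongr hPQX
      (angCongr_symm (mt Collinear.swap_left hPQX) hPQX hR)⟩
  · have hX := (sameSide_of_mem_ray hQ hS hXS).right
    rw [← angle_eq_right P (ne_of_inc_of_not_inc hQ hS).symm hXS,
      ← angle_eq_right Q (ne_of_inc_of_not_inc hP hST.right).symm hXT] at hPQS
    exact ⟨X, hX, len_eq_of_base_angCongr (not_collinear_of_not_inc hPQ hP hQ hX) hPQS⟩

lemma exists_mirrorImages {P Q : Point} (hPQ : P ≠ Q) : ∃ g, G.MirrorImages g P Q := by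
  obtain ⟨k, hP, hQ⟩ := G.exists_line hPQ
  obtain ⟨X, hX, hXP⟩ := exists_isosceles hPQ hP hQ
  obtain ⟨g, -, hg⟩ := exists_mirrorImages_of_isosceles hPQ hP hQ hX hXP
  exact ⟨g, hg⟩

end PerpendicularBisector

/-! ### Reflections -/

/-- A length-preserving permutation of the points. -/
def IsIsometry (G : PlaneGeometry Point Line) (φ : Equiv.Perm Point) : Prop :=
  ∀ A B, G.len (φ A) (φ B) = G.len A B

lemma IsIsometry.mul {φ ψ : Equiv.Perm Point} (hφ : G.IsIsometry φ) (hψ : G.IsIsometry ψ) :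
    G.IsIsometry (φ * ψ) :=
  fun A B => (hφ _ _).trans (hψ A B)

section Reflection

variable [HilbertPlane G]

lemma MirrorImages.inc_iff {g : Line} {A B X : Point} (h : G.MirrorImages g A B) :
    G.inc X g ↔ G.len X A = G.len X B :=
  ⟨h.len_eq X, h.inc_of_len_eq⟩

lemma MirrorImages.line_unique {g h : Line} {A B : Point} (hg : G.MirrorImages g A B)
    (hh : G.MirrorImages h A B) : g = h :=
  line_ext fun _ hX => hh.inc_iff.2 (hg.inc_iff.1 hX)

variable (G) in
open Classical in
/-- The image of the point `X` under the reflection in the line `g`. -/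
noncomputable def reflect (g : Line) (X : Point) : Point :=
  if h : G.inc X g then X else (exists_mirrorImages_of_not_inc h).choose

lemma reflect_of_inc {g : Line} {X : Point} (h : G.inc X g) : G.reflect g X = X :=
  dif_pos h

lemma mirrorImages_reflect {g : Line} {X : Point} (h : ¬ G.inc X g) :
    G.MirrorImages g X (G.reflect g X) := by
  rw [reflect, dif_neg h]
  exact (exists_mirrorImages_of_not_inc h).choose_spec

variable (G) in
lemma reflect_involutive (g : Line) : Function.Involutive (G.reflect g) := fun X => by
  by_cases h : G.inc X g
  · rw [reflect_of_inc h, reflect_of_inc h]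
  · have hX := mirrorImages_reflect h
    exact (mirrorImages_reflect hX.right).unique hX.symm

variable (G) in
/-- The reflection in the line `g`, as a permutation of the points. Relations between lines are
expressed below by identities in the group of permutations. -/
noncomputable def reflection (g : Line) : Equiv.Perm Point :=
  (G.reflect_involutive g).toPerm

lemma reflection_apply_of_inc {g : Line} {X : Point} (h : G.inc X g) : G.reflection g X = X :=
  reflect_of_inc h

lemma mirrorImages_reflection {g : Line} {X : Point} (h : ¬ G.inc X g) :
    G.MirrorImages g X (G.reflection g X) :=
  mirrorImages_reflect h

lemma MirrorImages.reflection_apply {g : Line} {X Y : Point} (h : G.MirrorImages g X Y) :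
    G.reflection g X = Y :=
  (mirrorImages_reflection h.left).unique h

lemma reflection_apply_eq_self_iff {g : Line} {X : Point} :
    G.reflection g X = X ↔ G.inc X g := by
  refine ⟨fun h => ?_, reflection_apply_of_inc⟩
  by_contra hX
  exact (mirrorImages_reflection hX).oppSide.ne h.symm

lemma mirrorImages_of_reflection_apply_ne {g : Line} {X : Point} (h : X ≠ G.reflection g X) :
    G.MirrorImages g X (G.reflection g X) :=
  mirrorImages_reflection fun hX => h (reflection_apply_of_inc hX).symm

variable (G) in
@[simp] lemma reflection_mul_self (g : Line) : G.reflection g * G.reflection g = 1 :=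
  Equiv.ext (G.reflect_involutive g)

variable (G) in
@[simp] lemma reflection_mul_cancel_left (g : Line) (φ : Equiv.Perm Point) :
    G.reflection g * (G.reflection g * φ) = φ := by
  rw [← mul_assoc, reflection_mul_self, one_mul]

variable (G) in
@[simp] lemma reflection_inv (g : Line) : (G.reflection g)⁻¹ = G.reflection g :=
  inv_eq_of_mul_eq_one_left (G.reflection_mul_self g)

lemma eq_reflection_mul_of_mul_eq {g : Line} {φ ψ : Equiv.Perm Point}
    (h : G.reflection g * φ = ψ) : φ = G.reflection g * ψ := by
  rw [← h, reflection_mul_cancel_left]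

lemma reflection_injective : Function.Injective G.reflection := fun _ _ H =>
  line_ext fun _ hX => reflection_apply_eq_self_iff.1 (H ▸ reflection_apply_of_inc hX)

variable (G) in
lemma exists_mirrorImages_of_line (g : Line) : ∃ A B, G.MirrorImages g A B :=
  let ⟨P, hP⟩ := G.exists_not_inc g
  ⟨P, _, mirrorImages_reflection hP⟩

variable (G) in
lemma reflection_ne_one (g : Line) : G.reflection g ≠ 1 := fun h => by
  obtain ⟨A, B, hAB⟩ := G.exists_mirrorImages_of_line g
  exact hAB.oppSide.ne (by rw [← hAB.reflection_apply, h, Equiv.Perm.one_apply])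

variable (G) in
lemma isIsometry_reflection (g : Line) : G.IsIsometry (G.reflection g) := fun A B => by
  by_cases hA : G.inc A g <;> by_cases hB : G.inc B g
  · rw [reflection_apply_of_inc hA, reflection_apply_of_inc hB]
  · rw [reflection_apply_of_inc hA, (mirrorImages_reflection hB).len_eq A hA]
  · rw [reflection_apply_of_inc hB, len_comm, ← (mirrorImages_reflection hA).len_eq B hB, len_comm]
  · exact ((mirrorImages_reflection hA).len_eq_len (mirrorImages_reflection hB)).symm

lemma IsIsometry.inc_of_mirrorImages {φ : Equiv.Perm Point} {k : Line} {A C : Point}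
    (hφ : G.IsIsometry φ) (hA : φ A = A) (hC : G.MirrorImages k C (φ C)) : G.inc A k :=
  hC.inc_of_len_eq (by rw [← hφ A C, hA])

lemma IsIsometry.mirrorImages {φ : Equiv.Perm Point} {g k : Line} {A B : Point}
    (hφ : G.IsIsometry φ) (hk : ∀ X, G.inc (φ X) k ↔ G.inc X g) (h : G.MirrorImages g A B) :
    G.MirrorImages k (φ A) (φ B) := by
  obtain ⟨l, hl⟩ := exists_mirrorImages (G := G) (φ.injective.ne h.oppSide.ne)
  obtain rfl : k = l := line_ext fun Y hY => by
    obtain ⟨X, rfl⟩ := φ.surjective Y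
    rwa [hl.inc_iff, hφ, hφ, ← h.inc_iff, ← hk]
  exact hl

lemma IsIsometry.exists_image {φ : Equiv.Perm Point} (hφ : G.IsIsometry φ) (g : Line) :
    ∃ k, ∀ X, G.inc (φ X) k ↔ G.inc X g := by
  obtain ⟨A, B, hAB⟩ := G.exists_mirrorImages_of_line g
  obtain ⟨k, hk⟩ := exists_mirrorImages (G := G) (φ.injective.ne hAB.oppSide.ne)
  exact ⟨k, fun X => by rw [hk.inc_iff, hφ, hφ, ← hAB.inc_iff]⟩

lemma IsIsometry.conj_reflection {φ : Equiv.Perm Point} {g k : Line} (hφ : G.IsIsometry φ)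
    (hk : ∀ X, G.inc (φ X) k ↔ G.inc X g) : φ * G.reflection g * φ⁻¹ = G.reflection k := by
  rw [mul_inv_eq_iff_eq_mul]
  refine Equiv.ext fun X => ?_
  simp only [Equiv.Perm.mul_apply]
  by_cases hX : G.inc X g
  · rw [reflection_apply_of_inc hX, reflection_apply_of_inc ((hk X).2 hX)]
  · exact (hφ.mirrorImages hk (mirrorImages_reflection hX)).reflection_apply.symm

/-- If `φ C ≠ C`, then `φ` followed by the reflection in `g` also fixes `C`, which is not on `g`. -/
lemma IsIsometry.eq_one_or_eq_reflection {φ : Equiv.Perm Point} {A B : Point} {g : Line}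
    (hφ : G.IsIsometry φ) (hAB : A ≠ B) (hA : φ A = A) (hB : φ B = B) (hAg : G.inc A g)
    (hBg : G.inc B g) : φ = 1 ∨ φ = G.reflection g := by
  have mirrorImages : ∀ {ψ : Equiv.Perm Point}, G.IsIsometry ψ → ψ A = A → ψ B = B →
      ∀ {C}, ψ C ≠ C → G.MirrorImages g C (ψ C) := by
    intro ψ hψ hA hB C hC
    obtain ⟨k, hk⟩ := exists_mirrorImages (G := G) hC.symm
    rwa [PlaneGeometry.line_unique hAB hAg hBg (hψ.inc_of_mirrorImages hA hk)
      (hψ.inc_of_mirrorImages hB hk)]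
  by_contra! H
  obtain ⟨C, hC⟩ : ∃ C, φ C ≠ C := by
    by_contra! h
    exact H.1 (Equiv.ext h)
  have hCg := mirrorImages hφ hA hB hC
  have hψ := (G.isIsometry_reflection g).mul hφ
  obtain ⟨D, hD⟩ : ∃ D, (G.reflection g * φ) D ≠ D := by
    by_contra! h
    exact H.2 ((eq_reflection_mul_of_mul_eq (ψ := 1) (Equiv.ext h)).trans (mul_one _))
  have hDg := mirrorImages hψ (by rw [Equiv.Perm.mul_apply, hA, reflection_apply_of_inc hAg])
    (by rw [Equiv.Perm.mul_apply, hB, reflection_apply_of_inc hBg]) hD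
  exact hCg.left (hψ.inc_of_mirrorImages hCg.symm.reflection_apply hDg)

variable (G) in
lemma reflection_mul_reflection_ne (a b c : Line) :
    G.reflection a * G.reflection b ≠ G.reflection c := by
  intro H
  have hab : a ≠ b := by
    rintro rfl
    exact G.reflection_ne_one c (by rw [← H, reflection_mul_self])
  have inc_of_inc : ∀ X, G.inc X c → G.inc X a ∧ G.inc X b := fun X hX => by
    have h : G.reflection b X = G.reflection a X := by
      rw [eq_reflection_mul_of_mul_eq H, Equiv.Perm.mul_apply, reflection_apply_of_inc hX]
    by_cases hXa : G.inc X a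
    · exact ⟨hXa, reflection_apply_eq_self_iff.1 (h.trans (reflection_apply_of_inc hXa))⟩
    · have ha := mirrorImages_reflection hXa
      exact absurd (ha.line_unique (h ▸ mirrorImages_of_reflection_apply_ne (h ▸ ha.oppSide.ne)))
        hab
  exact hab ((line_ext fun X hX => (inc_of_inc X hX).1).symm.trans
    (line_ext fun X hX => (inc_of_inc X hX).2))

/-- The theorem of the three reflections. If `X` lies on `c`, choose `d` so that the reflection in
`d` takes the image of `X` back to `X`. -/
lemma exists_reflection_mul_mul_eq {a b c : Line} {M : Point} (ha : G.inc M a) (hb : G.inc M b)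
    (hc : G.inc M c) :
    ∃ d, G.inc M d ∧ G.reflection a * G.reflection b * G.reflection c = G.reflection d := by
  obtain ⟨X, hX, hXc⟩ := G.exists_inc_ne c M
  have hab := (G.isIsometry_reflection a).mul (G.isIsometry_reflection b)
  have hM : (G.reflection a * G.reflection b) M = M := by
    rw [Equiv.Perm.mul_apply, reflection_apply_of_inc hb, reflection_apply_of_inc ha]
  obtain ⟨d, hMd, hdX⟩ : ∃ d, G.inc M d ∧
      G.reflection d ((G.reflection a * G.reflection b) X) = X := by
    by_cases h : X = (G.reflection a * G.reflection b) X
    · exact ⟨c, hc, by rw [← h, reflection_apply_of_inc hXc]⟩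
    · obtain ⟨d, hd⟩ := exists_mirrorImages (G := G) h
      exact ⟨d, hab.inc_of_mirrorImages hM hd, hd.symm.reflection_apply⟩
  refine ⟨d, hMd, ?_⟩
  have hd := ((G.isIsometry_reflection d).mul hab).eq_one_or_eq_reflection hX
    (by rw [Equiv.Perm.mul_apply, hdX])
    (by rw [Equiv.Perm.mul_apply, hM, reflection_apply_of_inc hMd]) hXc hc
  rcases hd with h | h
  · have h' := eq_reflection_mul_of_mul_eq h
    rw [mul_one] at h'
    exact absurd h' (G.reflection_mul_reflection_ne a b d)
  · rw [eq_reflection_mul_of_mul_eq h, mul_assoc, reflection_mul_self, mul_one]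

end Reflection

/-! ### Perpendicular lines -/

section Perp

/-- Two lines are perpendicular if they are distinct and the reflections in them commute. -/
structure Perp (G : PlaneGeometry Point Line) [HilbertPlane G] (g h : Line) : Prop where
  ne : g ≠ h
  commute : Commute (G.reflection g) (G.reflection h)

variable [HilbertPlane G]

lemma Perp.symm {g h : Line} (H : G.Perp g h) : G.Perp h g :=
  ⟨H.ne.symm, H.commute.symm⟩

lemma Perp.inc_reflection {g h : Line} (H : G.Perp g h) {X : Point} (hX : G.inc X h) :
    G.inc (G.reflection g X) h := by
  rw [← reflection_apply_eq_self_iff, ← Equiv.Perm.mul_apply, ← H.commute.eq,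
    Equiv.Perm.mul_apply, reflection_apply_of_inc hX]

lemma MirrorImages.perp {g h : Line} {A B : Point} (hAB : G.MirrorImages g A B)
    (hA : G.inc A h) (hB : G.inc B h) : G.Perp g h := by
  refine ⟨fun hgh => hAB.left (hgh ▸ hA), ?_⟩
  obtain ⟨k, hk⟩ := (G.isIsometry_reflection g).exists_image h
  have hBk := (hk A).2 hA
  have hAk := (hk B).2 hB
  rw [hAB.reflection_apply] at hBk
  rw [hAB.symm.reflection_apply] at hAk
  obtain rfl := PlaneGeometry.line_unique hAB.oppSide.ne hAk hBk hA hB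
  exact mul_inv_eq_iff_eq_mul.1 ((G.isIsometry_reflection g).conj_reflection hk)

lemma Perp.exists_inter {g h : Line} (H : G.Perp g h) : ∃ F, G.inc F g ∧ G.inc F h := by
  obtain ⟨X, hX, hXg⟩ := exists_inc_not_inc (G := G) H.ne.symm
  obtain ⟨F, hF, hXFX'⟩ := (mirrorImages_reflection hXg).oppSide.exists_btw
  exact ⟨F, hF, hXFX'.inc_middle hX (H.inc_reflection hX)⟩

variable (G) in
lemma exists_perp (g : Line) (P : Point) : ∃ h, G.inc P h ∧ G.Perp h g := by
  by_cases hP : G.inc P g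
  · obtain ⟨A, hA, hAg⟩ := G.exists_inc_ne g P
    obtain ⟨B, hAPB, hPB⟩ := G.exists_btw_len_eq hA.symm hA
    obtain ⟨h, hAB⟩ := exists_mirrorImages (G := G) hAPB.ne₁₃
    exact ⟨h, hAB.inc_of_len_eq hPB.symm, hAB.perp hAg (hAPB.inc_right hAg hP)⟩
  · have hPP' := mirrorImages_reflection hP
    obtain ⟨h, hPh, hP'h⟩ := G.exists_line hPP'.oppSide.ne
    exact ⟨h, hPh, (hPP'.perp hPh hP'h).symm⟩

lemma Perp.btw_and_len_eq {g h : Line} {A P : Point} (H : G.Perp h g) (hPh : G.inc P h)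
    (hPg : G.inc P g) (hAg : G.inc A g) (hA : ¬ G.inc A h) :
    G.btw A P (G.reflection h A) ∧ G.len P A = G.len P (G.reflection h A) :=
  have hAA' := mirrorImages_reflection hA
  ⟨hAA'.oppSide.btw hPh hAg hPg (H.inc_reflection hAg), hAA'.len_eq P hPh⟩

lemma perp_unique {g h k : Line} {P : Point} (hh : G.Perp h g) (hk : G.Perp k g)
    (hPh : G.inc P h) (hPk : G.inc P k) : h = k := by
  by_cases hP : G.inc P g
  swap
  · exact line_unique (mirrorImages_reflection hP).oppSide.ne hPh (hh.symm.inc_reflection hPh) hPk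
      (hk.symm.inc_reflection hPk)
  obtain ⟨A, hA, hAg⟩ := G.exists_inc_ne g P
  have hAh : ¬ G.inc A h := fun hAh => hA (inter_unique hh.ne hAh hAg hPh hP)
  have hAk : ¬ G.inc A k := fun hAk => hA (inter_unique hk.ne hAk hAg hPk hP)
  obtain ⟨hb, hl⟩ := hh.btw_and_len_eq hPh hP hAg hAh
  obtain ⟨hb', hl'⟩ := hk.btw_and_len_eq hPk hP hAg hAk
  have hAA' : G.reflection k A = G.reflection h A :=
    eq_of_len_eq_of_mem_ray hb.ne₂₃.symm (hb.mem_ray_of_btw hb') (hl.symm.trans hl')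
  exact (mirrorImages_reflection hAh).line_unique (hAA' ▸ mirrorImages_reflection hAk)

end Perp

/-! ### Half-turns -/

section HalfTurn

variable [HilbertPlane G]

lemma reflection_mul_reflection_eq_of_perp {a b c d : Line} {N : Point} (hab : G.Perp a b)
    (hcd : G.Perp c d) (ha : G.inc N a) (hb : G.inc N b) (hc : G.inc N c) (hd : G.inc N d) :
    G.reflection a * G.reflection b = G.reflection c * G.reflection d := by
  obtain ⟨l, hl, h⟩ := exists_reflection_mul_mul_eq hc ha hb
  rw [mul_assoc] at h
  have hcl := eq_reflection_mul_of_mul_eq h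
  have hlc : G.Perp l c := by
    refine ⟨?_, ?_⟩
    · rintro rfl
      rw [reflection_mul_self] at hcl
      have hab' := eq_reflection_mul_of_mul_eq hcl
      exact hab.ne (reflection_injective (by rw [hab', mul_one])).symm
    · have hlc := congrArg (·⁻¹) hcl
      simp only [mul_inv_rev, reflection_inv, ← hab.commute.eq] at hlc
      exact hlc.symm.trans hcl
  rw [hcl, perp_unique hlc hcd.symm hl hd]

variable (G) in
lemma exists_perp_perp (N : Point) : ∃ a b, G.inc N a ∧ G.inc N b ∧ G.Perp a b := by
  obtain ⟨k⟩ := IncidencePlane.nonempty_line (G := G)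
  obtain ⟨b, hb, -⟩ := G.exists_perp k N
  obtain ⟨a, ha, hab⟩ := G.exists_perp b N
  exact ⟨a, b, ha, hb, hab⟩

variable (G) in
/-- The half-turn about `N`, the product of the reflections in two perpendicular lines through
`N`. -/
noncomputable def halfTurn (N : Point) : Equiv.Perm Point :=
  G.reflection (G.exists_perp_perp N).choose *
    G.reflection (G.exists_perp_perp N).choose_spec.choose

lemma Perp.mul_eq_halfTurn {a b : Line} {N : Point} (hab : G.Perp a b) (ha : G.inc N a)
    (hb : G.inc N b) : G.reflection a * G.reflection b = G.halfTurn N :=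
  let ⟨hc, hd, hcd⟩ := (G.exists_perp_perp N).choose_spec.choose_spec
  reflection_mul_reflection_eq_of_perp hab hcd ha hb hc hd

lemma Perp.reflection_eq_mul_halfTurn {a b : Line} {N : Point} (hab : G.Perp a b)
    (ha : G.inc N a) (hb : G.inc N b) : G.reflection a = G.reflection b * G.halfTurn N := by
  rw [← hab.symm.mul_eq_halfTurn hb ha, reflection_mul_cancel_left]

variable (G) in
lemma isIsometry_halfTurn (N : Point) : G.IsIsometry (G.halfTurn N) :=
  (G.isIsometry_reflection _).mul (G.isIsometry_reflection _)

variable (G) in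
@[simp] lemma halfTurn_mul_self (N : Point) : G.halfTurn N * G.halfTurn N = 1 := by
  obtain ⟨a, b, ha, hb, hab⟩ := G.exists_perp_perp N
  nth_rw 1 [← hab.symm.mul_eq_halfTurn hb ha]
  rw [← hab.mul_eq_halfTurn ha hb, mul_assoc, reflection_mul_cancel_left, reflection_mul_self]

lemma commute_halfTurn {N : Point} {g : Line} (hg : G.inc N g) :
    Commute (G.halfTurn N) (G.reflection g) := by
  obtain ⟨h, hh, hhg⟩ := G.exists_perp g N
  rw [← hhg.mul_eq_halfTurn hh hg]
  exact hhg.commute.mul_left (Commute.refl _)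

variable (G) in
lemma halfTurn_apply_self (N : Point) : G.halfTurn N N = N := by
  obtain ⟨a, b, ha, hb, hab⟩ := G.exists_perp_perp N
  rw [← hab.mul_eq_halfTurn ha hb, Equiv.Perm.mul_apply, reflection_apply_of_inc hb,
    reflection_apply_of_inc ha]

variable (G) in
lemma exists_halfTurn_apply_eq (M O : Point) : ∃ N, G.halfTurn N M = O := by
  rcases eq_or_ne M O with rfl | hMO
  · exact ⟨M, G.halfTurn_apply_self M⟩
  obtain ⟨m, hm⟩ := exists_mirrorImages (G := G) hMO
  obtain ⟨n, hMn, hOn⟩ := G.exists_line hMO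
  have hmn := hm.perp hMn hOn
  obtain ⟨N, hNm, hNn⟩ := hmn.exists_inter
  refine ⟨N, ?_⟩
  rw [← hmn.mul_eq_halfTurn hNm hNn, Equiv.Perm.mul_apply, reflection_apply_of_inc hMn,
    hm.reflection_apply]

end HalfTurn

/-! ### Directions -/

section Direction

/-- Two lines have the same direction if they are equal or parallel. -/
def SameDirection (G : PlaneGeometry Point Line) (g h : Line) : Prop :=
  g = h ∨ G.Parallel g h

lemma SameDirection.symm {g h : Line} (H : G.SameDirection g h) : G.SameDirection h g :=
  H.imp Eq.symm fun H X hX => H X hX.symm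

lemma SameDirection.eq_of_inc {g h : Line} {P : Point} (H : G.SameDirection g h)
    (hPg : G.inc P g) (hPh : G.inc P h) : g = h :=
  H.resolve_right fun H => H P ⟨hPg, hPh⟩

lemma not_sameDirection_of_inc {g h : Line} {P Q : Point} (hPg : G.inc P g) (hPh : G.inc P h)
    (hQg : ¬ G.inc Q g) (hQh : G.inc Q h) : ¬ G.SameDirection h g :=
  fun H => hQg (H.eq_of_inc hPh hPg ▸ hQh)

lemma exists_inter_of_not_sameDirection {g h : Line} (H : ¬ G.SameDirection g h) :
    ∃ P, G.inc P g ∧ G.inc P h := by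
  by_contra! hgh
  exact H (Or.inr fun X hX => hgh X hX.1 hX.2)

lemma sameDirection_of_perp [HilbertPlane G] {g h k : Line} (hg : G.Perp g k)
    (hh : G.Perp h k) : G.SameDirection g h := by
  by_contra H
  obtain ⟨P, hPg, hPh⟩ := exists_inter_of_not_sameDirection H
  exact H (Or.inl (perp_unique hg hh hPg hPh))

lemma Perp.of_conj [HilbertPlane G] {φ : Equiv.Perm Point} {g h g' h' : Line} (H : G.Perp g h)
    (hg : MulAut.conj φ (G.reflection g) = G.reflection g')
    (hh : MulAut.conj φ (G.reflection h) = G.reflection h') : G.Perp g' h' where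
  ne := by
    rintro rfl
    exact H.ne (reflection_injective ((MulAut.conj φ).injective (hg.trans hh.symm)))
  commute := by
    rw [← hg, ← hh]
    exact H.commute.map (MulAut.conj φ)

lemma sameDirection_of_conj_halfTurn [HilbertPlane G] {N : Point} {g k : Line}
    (hk : MulAut.conj (G.halfTurn N) (G.reflection g) = G.reflection k) :
    G.SameDirection g k := by
  obtain ⟨m, hm, hmg⟩ := G.exists_perp g N
  have hmm : MulAut.conj (G.halfTurn N) (G.reflection m) = G.reflection m := by
    rw [MulAut.conj_apply, (commute_halfTurn hm).eq, mul_inv_cancel_right]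
  exact sameDirection_of_perp hmg.symm (hmg.symm.of_conj hk hmm)

variable [EuclideanPlane G]

lemma Perp.of_sameDirection {g h k : Line} (hg : G.Perp g k) (H : G.SameDirection g h) :
    G.Perp h k := by
  rcases H with rfl | H
  · exact hg
  obtain ⟨A, -⟩ := G.exists_not_inc g
  obtain ⟨P, -, hPh⟩ := G.exists_inc_ne h A
  have hPg : ¬ G.inc P g := fun hPg => H P ⟨hPg, hPh⟩
  obtain ⟨m, hPm, hmk⟩ := G.exists_perp k P
  have hgm : G.Parallel g m :=
    (sameDirection_of_perp hg hmk).resolve_left (by rintro rfl; exact hPg hPm)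
  rwa [EuclideanPlane.parallel P g h m hPg hPh hPm H hgm]

lemma SameDirection.trans {g h k : Line} (hgh : G.SameDirection g h)
    (hhk : G.SameDirection h k) : G.SameDirection g k := by
  obtain ⟨P, -⟩ := G.exists_not_inc h
  obtain ⟨m, -, hmh⟩ := G.exists_perp h P
  exact sameDirection_of_perp (hmh.symm.of_sameDirection hgh.symm)
    (hmh.symm.of_sameDirection hhk)

variable (G) in
lemma exists_sameDirection (O : Point) (g : Line) : ∃ h, G.inc O h ∧ G.SameDirection g h := by
  obtain ⟨k, -, hkg⟩ := G.exists_perp g O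
  obtain ⟨h, hO, hhk⟩ := G.exists_perp k O
  exact ⟨h, hO, sameDirection_of_perp hkg.symm hhk⟩

variable (G) in
/-- The line through `O` with the same direction as `g`. -/
noncomputable def lineThrough (O : Point) (g : Line) : Line :=
  (G.exists_sameDirection O g).choose

variable (G) in
lemma inc_lineThrough (O : Point) (g : Line) : G.inc O (G.lineThrough O g) :=
  (G.exists_sameDirection O g).choose_spec.1

variable (G) in
lemma sameDirection_lineThrough (O : Point) (g : Line) :
    G.SameDirection g (G.lineThrough O g) :=
  (G.exists_sameDirection O g).choose_spec.2

lemma lineThrough_eq_iff {O : Point} {g h : Line} (hO : G.inc O h) :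
    G.lineThrough O g = h ↔ G.SameDirection g h :=
  ⟨fun H => H ▸ G.sameDirection_lineThrough O g,
    fun H => ((G.sameDirection_lineThrough O g).symm.trans H).eq_of_inc (G.inc_lineThrough O g) hO⟩

lemma lineThrough_eq_self {O : Point} {g : Line} (hO : G.inc O g) : G.lineThrough O g = g :=
  (lineThrough_eq_iff hO).2 (Or.inl rfl)

lemma lineThrough_eq_lineThrough_iff {O : Point} {g h : Line} :
    G.lineThrough O g = G.lineThrough O h ↔ G.SameDirection g h := by
  rw [lineThrough_eq_iff (G.inc_lineThrough O h)]
  have hh := G.sameDirection_lineThrough O h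
  exact ⟨fun H => H.trans hh.symm, fun H => H.trans hh⟩

lemma conj_halfTurn_reflection_lineThrough {M N O : Point} (hN : G.halfTurn N M = O) (g : Line) :
    MulAut.conj (G.halfTurn N) (G.reflection (G.lineThrough M g)) =
      G.reflection (G.lineThrough O g) := by
  obtain ⟨k, hk⟩ := (G.isIsometry_halfTurn N).exists_image (G.lineThrough M g)
  have hkr := (G.isIsometry_halfTurn N).conj_reflection hk
  have hOk : G.inc O k := by
    rw [← hN, hk]
    exact G.inc_lineThrough M g
  rw [MulAut.conj_apply, hkr, (lineThrough_eq_iff hOk).2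
    ((G.sameDirection_lineThrough M g).trans (sameDirection_of_conj_halfTurn hkr))]

lemma Perp.reflection_eq_reflection_lineThrough_mul {M : Point} {a g : Line} (ha : G.Perp a g)
    (hM : G.inc M a) :
    G.reflection a = G.reflection (G.lineThrough M g) * G.halfTurn M :=
  (ha.symm.of_sameDirection (G.sameDirection_lineThrough M g)).symm.reflection_eq_mul_halfTurn hM
    (G.inc_lineThrough M g)

end Direction

/-! ### Antiparallel lines -/

section Antiparallel

variable [EuclideanPlane G]

/-- The lines `h` and `k` are antiparallel with respect to the lines `g` and `g'`: once the four
lines are translated to a common point, the rotation carrying `g'` to `h` carries `k` to `g`. The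
common point is immaterial, see `antiparallel_of_mul_eq`. -/
def Antiparallel (G : PlaneGeometry Point Line) [EuclideanPlane G] (g g' h k : Line) : Prop :=
  ∀ O, G.reflection (G.lineThrough O h) * G.reflection (G.lineThrough O g) *
    G.reflection (G.lineThrough O k) = G.reflection (G.lineThrough O g')

lemma antiparallel_of_mul_eq {M : Point} {g g' h k : Line}
    (H : G.reflection (G.lineThrough M h) * G.reflection (G.lineThrough M g) *
      G.reflection (G.lineThrough M k) = G.reflection (G.lineThrough M g')) :
    G.Antiparallel g g' h k := fun O => by
  obtain ⟨N, hN⟩ := G.exists_halfTurn_apply_eq M O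
  simp only [← conj_halfTurn_reflection_lineThrough hN, ← map_mul, H]

lemma Antiparallel.symm {g g' h k : Line} (H : G.Antiparallel g g' h k) :
    G.Antiparallel g g' k h := fun O => by
  have hO := congrArg (·⁻¹) (H O)
  simpa only [mul_inv_rev, reflection_inv, mul_assoc] using hO

lemma Antiparallel.of_sameDirection {g g' h k l : Line} (H : G.Antiparallel g g' h k)
    (hkl : G.SameDirection k l) : G.Antiparallel g g' h l := fun O => by
  rw [← lineThrough_eq_lineThrough_iff.2 hkl, H O]

lemma Antiparallel.sameDirection {g g' h k l : Line} (hk : G.Antiparallel g g' h k)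
    (hl : G.Antiparallel g g' h l) : G.SameDirection k l := by
  obtain ⟨O, -⟩ := G.exists_not_inc g
  rw [← lineThrough_eq_lineThrough_iff (O := O)]
  exact reflection_injective (mul_left_cancel ((hk O).trans (hl O).symm))

/-- Passing from a line through `M` to the perpendicular through `M` multiplies the reflection by
the half-turn about `M`, an involution that commutes with the reflections in the lines through
`M`. -/
lemma antiparallel_of_perp_of_mul_eq {M : Point} {a b c d g g' h k : Line} (hag : G.Perp a g)
    (hbg' : G.Perp b g') (hch : G.Perp c h) (hdk : G.Perp d k) (ha : G.inc M a) (hb : G.inc M b)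
    (hc : G.inc M c) (hd : G.inc M d)
    (H : G.reflection d * G.reflection b * G.reflection c = G.reflection a) :
    G.Antiparallel g g' k h := by
  refine antiparallel_of_mul_eq (M := M) ?_
  have ht : Commute (G.halfTurn M) (G.reflection (G.lineThrough M g')) :=
    commute_halfTurn (G.inc_lineThrough M g')
  have H' : G.reflection (G.lineThrough M k) * G.reflection (G.lineThrough M g') *
      G.reflection (G.lineThrough M h) = G.reflection (G.lineThrough M g) := by
    refine mul_right_cancel (b := G.halfTurn M) ?_
    rw [← hag.reflection_eq_reflection_lineThrough_mul ha, ← H,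
      hbg'.reflection_eq_reflection_lineThrough_mul hb,
      hch.reflection_eq_reflection_lineThrough_mul hc,
      hdk.reflection_eq_reflection_lineThrough_mul hd, ← ht.eq]
    simp only [mul_assoc]
    rw [← mul_assoc (G.halfTurn M) (G.halfTurn M), halfTurn_mul_self, one_mul]
  rw [← H']
  simp only [mul_assoc, reflection_mul_cancel_left, reflection_mul_self, mul_one]

/-- Opposite sides of a cyclic quadrilateral are antiparallel with respect to the other two. Here
`M` is the centre of the circle; the reflections in the perpendiculars through `M` to the four
sides carry `Y → X → Z → W → Y`, whence the relation between them. -/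
lemma antiparallel_of_cyclic {M X Y Z W : Point} {a b g g' xz yw : Line}
    (ha : G.MirrorImages a X Y) (hMa : G.inc M a) (hX : G.inc X g) (hY : G.inc Y g)
    (hb : G.Perp b g') (hMb : G.inc M b) (hZW : G.reflection b Z = W) (hMXZ : G.len M X = G.len M Z)
    (hXZ : X ≠ Z) (hYW : Y ≠ W) (hxz : G.inc X xz ∧ G.inc Z xz) (hyw : G.inc Y yw ∧ G.inc W yw) :
    G.Antiparallel g g' yw xz := by
  obtain ⟨c, hc⟩ := exists_mirrorImages (G := G) hXZ
  obtain ⟨d, hd⟩ := exists_mirrorImages (G := G) hYW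
  have hMZW : G.len M Z = G.len M W := by
    rw [← G.isIsometry_reflection b M Z, hZW, reflection_apply_of_inc hMb]
  have hMc := hc.inc_of_len_eq hMXZ
  have hMd := hd.inc_of_len_eq ((ha.len_eq M hMa).symm.trans (hMXZ.trans hMZW))
  have hdbc : G.reflection d * G.reflection b * G.reflection c = G.reflection a := by
    obtain ⟨e, -, he⟩ := exists_reflection_mul_mul_eq hMd hMb hMc
    have heX : G.reflection e X = Y := by
      simp only [← he, Equiv.Perm.mul_apply, hc.reflection_apply, hZW, hd.symm.reflection_apply]
    rw [he, ha.line_unique (heX ▸ mirrorImages_of_reflection_apply_ne (heX ▸ ha.oppSide.ne))]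
  exact antiparallel_of_perp_of_mul_eq (ha.perp hX hY) hb (hc.perp hxz.1 hxz.2)
    (hd.perp hyw.1 hyw.2) hMa hMb hMc hMd hdbc

/-- The circle through `X`, `Y` and `Z` meets `g'` again in a point that must be `W`, and in the
cyclic quadrilateral the two pairs of opposite sides can be exchanged. -/
lemma Antiparallel.swap {X Y Z W : Point} {g g' xz yw xw yz : Line}
    (H : G.Antiparallel g g' xz yw) (hXY : X ≠ Y) (hX : G.inc X g ∧ ¬ G.inc X g')
    (hY : G.inc Y g ∧ ¬ G.inc Y g') (hZ : G.inc Z g' ∧ ¬ G.inc Z g) (hW : G.inc W g')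
    (hxz : G.inc X xz ∧ G.inc Z xz) (hyw : G.inc Y yw ∧ G.inc W yw)
    (hxw : G.inc X xw ∧ G.inc W xw) (hyz : G.inc Y yz ∧ G.inc Z yz) :
    G.Antiparallel g g' xw yz := by
  have hXZ : X ≠ Z := ne_of_inc_of_not_inc hX.1 hZ.2
  obtain ⟨a, ha⟩ := exists_mirrorImages (G := G) hXY
  obtain ⟨c, hc⟩ := exists_mirrorImages (G := G) hXZ
  obtain ⟨M, hMa, hMc⟩ : ∃ M, G.inc M a ∧ G.inc M c :=
    exists_inter_of_not_sameDirection fun hac => hZ.2 <|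
      perp_unique ((ha.perp hX.1 hY.1).of_sameDirection hac).symm (hc.perp hxz.1 hxz.2).symm
        hX.1 hxz.1 ▸ hxz.2
  have hMXZ := hc.len_eq M hMc
  obtain ⟨b, hMb, hb⟩ := G.exists_perp g' M
  have hbZ := hb.inc_reflection hZ.1
  have hYbZ : Y ≠ G.reflection b Z := (ne_of_inc_of_not_inc hbZ hY.2).symm
  have hZW : G.reflection b Z = W := by
    obtain ⟨y, hYy, hbZy⟩ := G.exists_line hYbZ
    have hy : G.Antiparallel g g' y xz :=
      antiparallel_of_cyclic ha hMa hX.1 hY.1 hb hMb rfl hMXZ hXZ hYbZ hxz ⟨hYy, hbZy⟩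
    obtain rfl := (hy.symm.sameDirection H).eq_of_inc hYy hyw.1
    exact inter_unique (by rintro rfl; exact hY.2 hYy) hbZy hbZ hyw.2 hW
  have hMXW : G.len M X = G.len M W := by
    rw [hMXZ, ← G.isIsometry_reflection b M Z, hZW, reflection_apply_of_inc hMb]
  have hWZ : G.reflection b W = Z := by
    rw [← hZW, ← Equiv.Perm.mul_apply, reflection_mul_self, Equiv.Perm.one_apply]
  exact (antiparallel_of_cyclic ha hMa hX.1 hY.1 hb hMb hWZ hMXW
    (ne_of_inc_of_not_inc hW hX.2).symm (ne_of_inc_of_not_inc hY.1 hZ.2) hxw hyz).symm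

lemma exists_antiparallel_inter {A : Point} {g g' h : Line} (hA : G.inc A g ∧ ¬ G.inc A g')
    (hg : ¬ G.SameDirection h g) (hg' : ¬ G.SameDirection h g') :
    ∃ D k, (G.inc D g' ∧ ¬ G.inc D g) ∧ (G.inc A k ∧ G.inc D k) ∧ G.Antiparallel g g' k h := by
  obtain ⟨k, hAk, hk⟩ := exists_reflection_mul_mul_eq (G.inc_lineThrough A g')
    (G.inc_lineThrough A h) hA.1
  have H : G.reflection k * G.reflection g * G.reflection (G.lineThrough A h) =
      G.reflection (G.lineThrough A g') := by
    simp only [← hk, mul_assoc, reflection_mul_self, mul_one]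
  obtain ⟨D, hDg', hDk⟩ : ∃ D, G.inc D g' ∧ G.inc D k := by
    refine exists_inter_of_not_sameDirection fun hgk => hg ((lineThrough_eq_iff hA.1).1 ?_)
    rw [(lineThrough_eq_iff hAk).2 hgk, mul_assoc, mul_eq_left] at H
    have hgh := eq_reflection_mul_of_mul_eq H
    rw [mul_one] at hgh
    exact reflection_injective hgh
  have hDg : ¬ G.inc D g := fun hDg => by
    refine hg' ((lineThrough_eq_lineThrough_iff (O := A)).1 (reflection_injective (G := G) ?_))
    rw [← H, line_unique (ne_of_inc_of_not_inc hDg' hA.2).symm hAk hDk hA.1 hDg,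
      reflection_mul_self, one_mul]
  refine ⟨D, k, ⟨hDg', hDg⟩, ⟨hAk, hDk⟩, antiparallel_of_mul_eq (M := A) ?_⟩
  rw [lineThrough_eq_self hAk, lineThrough_eq_self hA.1, H]

end Antiparallel

end PlaneGeometry

open PlaneGeometry in
theorem mainTheorem10 {Point Line : Type*} (G : PlaneGeometry Point Line)
    (hI : G.IncidenceAxioms) (hII : G.OrderAxioms) (hIII : G.CongruenceAxioms)
    (hIV : G.ParallelAxiom)
    (g g' : Line) (A B C A' B' C' : Point)
    (hA : G.inc A g ∧ ¬ G.inc A g') (hB : G.inc B g ∧ ¬ G.inc B g')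
    (hC : G.inc C g ∧ ¬ G.inc C g')
    (hA' : G.inc A' g' ∧ ¬ G.inc A' g) (hB' : G.inc B' g' ∧ ¬ G.inc B' g)
    (hC' : G.inc C' g' ∧ ¬ G.inc C' g)
    (hAB : A ≠ B)
    (lBC' lB'C lAC' lA'C lAB' lA'B : Line)
    (hBC' : G.inc B lBC' ∧ G.inc C' lBC') (hB'C : G.inc B' lB'C ∧ G.inc C lB'C)
    (hAC' : G.inc A lAC' ∧ G.inc C' lAC') (hA'C : G.inc A' lA'C ∧ G.inc C lA'C)
    (hAB' : G.inc A lAB' ∧ G.inc B' lAB') (hA'B : G.inc A' lA'B ∧ G.inc B lA'B)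
    (h₁ : G.Parallel lBC' lB'C) (h₂ : G.Parallel lAC' lA'C) :
    G.Parallel lAB' lA'B := by
  have : G.EuclideanPlane :=
    { nonempty_line := ⟨g⟩, incidence := hI, order := hII, congruence := hIII, parallel := hIV }
  have hBC : B ≠ C := by rintro rfl; exact h₁ B ⟨hBC'.1, hB'C.2⟩
  have hAC : A ≠ C := by rintro rfl; exact h₂ A ⟨hAC'.1, hA'C.2⟩
  obtain ⟨D, lAD, hD, hAD, hAD_BC'⟩ : ∃ D lAD, (G.inc D g' ∧ ¬ G.inc D g) ∧
      (G.inc A lAD ∧ G.inc D lAD) ∧ G.Antiparallel g g' lAD lBC' :=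
    exists_antiparallel_inter hA (not_sameDirection_of_inc hB.1 hBC'.1 hC'.2 hBC'.2)
      (not_sameDirection_of_inc hC'.1 hBC'.2 hB.2 hBC'.1)
  obtain ⟨lBD, hBD⟩ := G.exists_line (ne_of_inc_of_not_inc hB.1 hD.2)
  obtain ⟨lCD, hCD⟩ := G.exists_line (ne_of_inc_of_not_inc hC.1 hD.2)
  have hAC'_BD : G.Antiparallel g g' lAC' lBD :=
    hAD_BC'.swap hAB hA hB hD hC'.1 hAD hBC' hAC' hBD
  have hBD_CA' : G.Antiparallel g g' lBD lA'C := hAC'_BD.symm.of_sameDirection (Or.inr h₂)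
  have hBA'_CD : G.Antiparallel g g' lA'B lCD :=
    hBD_CA'.swap hBC hB hC hD hA'.1 hBD hA'C.symm hA'B.symm hCD
  have hAD_CB' : G.Antiparallel g g' lAD lB'C := hAD_BC'.of_sameDirection (Or.inr h₁)
  have hAB'_CD : G.Antiparallel g g' lAB' lCD :=
    hAD_CB'.swap hAC hA hC hD hB'.1 hAD hB'C.symm hAB' hCD
  refine (hAB'_CD.symm.sameDirection hBA'_CD.symm).resolve_left ?_
  rintro rfl
  exact hB'.2 (line_unique hAB hAB'.1 hA'B.2 hA.1 hB.1 ▸ hAB'.2)
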